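/- Let $l$ be an odd prime, let $K$ be a field of characteristic $0$ (for instance $K=\mathbb{Q}$ or $\mathbb{Q}(a)$), and let $a\in K$ with $a\neq 0$ and $1-4a\neq 0$. Put $b=\dfrac{2(1+4a)}{1-4a}$. Let $Y$ be the smooth projective curve over $K$ given by the affine equation $$t^l=\frac{x^2+x+a}{x^2-x+a}.$$ Then $Y$ is a hyperelliptic curve of genus $l-1$. Over $K$ it is birational to $$y^2=(1-4a)\,(z^{2l}+bz^l+1),$$ a quadratic twist of $y^2=z^{2l}+bz^l+1$. If $1-4a$ is a square in $K$, then $Y$ has the model $y^2=z^{2l}+bz^l+1$. There is an involution $\alpha:(x,t)\mapsto(-x,1/t)$ of $Y$ over $K$. Let $X=Y/\langle\alpha\rangle$, the smooth projective curve whose function field is $K(Y)^{\langle\alpha\rangle}$. Let $\zeta_l\in\mathbb{C}$ be a primitive $l$-th root of unity and let $g_l\in\mathbb{Q}[T]$ be the minimal polynomial of $-\zeta_l-\zeta_l^{-1}$ over $\mathbb{Q}$. Then $X$ has genus $\frac{l-1}{2}$ and is a double cover of $\mathbb{P}^1_K$ (hence hyperelliptic if $l\geq 5$; if $l=3$ it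 has genus $1$). Over $K$ it is birational to $$\mu^2=(1-4a)\,(w+2)\,\bigl(w\,g_l(w^2-2)+b\bigr).$$ If $1-4a$ is a square in $K$, then $X$ has the model $$\mu^2=(w+2)\,\bigl(w\,g_l(w^2-2)+b\bigr).$$ In all four models the polynomial on the right-hand side has no multiple root. -/

import Mathlib

open Polynomial
open scoped KaehlerDifferential

noncomputable section

namespace PlaneCurve

variable {K : Type*} [Field K]

/-- The affine coordinate ring `K[x, y] / (f)` of the plane curve `f = 0`; here `K[X][X]` is
`K[x][y]`, the outer variable being the second coordinate `y`. -/
abbrev CoordinateRing (f : K[X][X]) : Type _ := AdjoinRoot f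

/-- The function field `K(x, y)` of the plane curve `f = 0`: the total ring of fractions of its
coordinate ring, a field as soon as `f` is irreducible. -/
abbrev FunctionField (f : K[X][X]) : Type _ := FractionRing (CoordinateRing f)

/-- The first coordinate function of the curve `f = 0`. -/
def coordX (f : K[X][X]) : FunctionField f :=
  algebraMap (CoordinateRing f) (FunctionField f) (AdjoinRoot.of f X)

/-- The second coordinate function of the curve `f = 0`. -/
def coordY (f : K[X][X]) : FunctionField f :=
  algebraMap (CoordinateRing f) (FunctionField f) (AdjoinRoot.root f)

instance isDomain_coordinateRing (f : K[X][X]) [hf : Fact (Irreducible f)] :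
    IsDomain (CoordinateRing f) :=
  AdjoinRoot.isDomain_of_prime hf.out.prime

end PlaneCurve

/-! A smooth projective curve over a field `K` of characteristic zero is handled through its
function field `F` over `K`; its closed points are the nontrivial valuation rings of `F`
containing `K`. -/

namespace AlgCurve

variable (K : Type*) [Field K] (F : Type*) [Field F] [Algebra K F]

/-- The image in `Ω[F⁄K]` of the module of differentials of the valuation ring `O ⊇ K`: the
differentials that are regular at the point `O`. -/
def regularDifferentialsAt (O : ValuationSubring F) : Submodule K (Ω[F⁄K]) :=
  Submodule.span K {ω | ∃ f ∈ O, ∃ g ∈ O, ω = f • KaehlerDifferential.D K F g}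

/-- The global regular differentials: those that are regular at every point. -/
def regularDifferentials : Submodule K (Ω[F⁄K]) :=
  ⨅ (O : ValuationSubring F) (_ : ∀ c : K, algebraMap K F c ∈ O), regularDifferentialsAt K F O

/-- The genus: the dimension of the space of global regular differentials. -/
def genus : ℕ := Module.finrank K (regularDifferentials K F)

/-- The curve is geometrically irreducible (`K` is algebraically closed in `F`, in characteristic
zero) and carries a morphism of degree two to the projective line over `K`. -/
def IsDoubleCoverOfLine : Prop :=
  algebraicClosure K F = ⊥ ∧
    ∃ z : F, Transcendental K z ∧ Module.finrank (IntermediateField.adjoin K {z}) F = 2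

/-- A hyperelliptic curve: a double cover of the projective line, of genus at least two. -/
def IsHyperelliptic : Prop :=
  IsDoubleCoverOfLine K F ∧ 2 ≤ genus K F

/-- `y ^ 2 = h(z)`, with `h` without multiple roots, is a model over `K` of the curve. -/
def HasModel (h : K[X]) : Prop :=
  h.Separable ∧ Nonempty (F ≃ₐ[K] PlaneCurve.FunctionField (X ^ 2 - C h : K[X][X]))

end AlgCurve

namespace DihedralCover

variable {K : Type*} [Field K]

/-- The plane curve `t ^ l = (x ^ 2 + x + a) / (x ^ 2 - x + a)`, denominator cleared; `x` is the
first coordinate and `t` the second. -/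
def poly (l : ℕ) (a : K) : K[X][X] :=
  C (X ^ 2 - X + C a) * X ^ l - C (X ^ 2 + X + C a)

theorem irreducible_poly [CharZero K] {l : ℕ} (hl : l ≠ 0) {a : K} (ha : a ≠ 0)
    (ha' : 1 - 4 * a ≠ 0) : Irreducible (poly l a) := by
  set P : K[X] := X ^ 2 + X + C a with hP
  set Q : K[X] := X ^ 2 - X + C a with hQ
  have h2 : (C (2⁻¹ : K) : K[X]) * 2 = 1 := by
    rw [show (2 : K[X]) = C 2 from rfl, ← C_mul]; simp
  have hCa : (C a⁻¹ : K[X]) * C a = 1 := by rw [← C_mul]; simp [ha]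
  have hcop : IsCoprime P Q := by
    refine ⟨C a⁻¹ * C 2⁻¹ * (1 - X), C a⁻¹ * C 2⁻¹ * (1 + X), ?_⟩
    rw [hP, hQ]
    linear_combination (C a⁻¹ * C a) * h2 + hCa
  have hlead : Q ≠ 0 := by
    intro h
    have := congrArg (fun p : K[X] => p.coeff 2) h
    simp [hQ, coeff_X] at this
  have hPdeg : P.natDegree = 2 := by rw [hP]; compute_degree!
  have hPu : ¬ IsUnit P := fun h => by
    have := natDegree_eq_zero_of_isUnit h
    omega
  have hP0 : P ≠ 0 := by intro h; rw [h] at hPdeg; simp at hPdeg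
  obtain ⟨p, hp, hpP⟩ := WfDvdMonoid.exists_irreducible_factor hPu hP0
  have hpQ : ¬ p ∣ Q := fun h => hp.not_isUnit (hcop.isUnit_of_dvd' hpP h)
  have hsep : IsCoprime P (derivative P) := by
    have hd : derivative P = 2 * X + 1 := by
      rw [hP]; simp; norm_num
    have h4 : (C (1 - 4 * a)⁻¹ : K[X]) * (1 - 4 * C a) = 1 := by
      rw [show (4 : K[X]) = C 4 from rfl, ← C_1, ← C_mul, ← C_sub, ← C_mul]
      simp [ha']
    refine ⟨C (1 - 4 * a)⁻¹ * (-4), C (1 - 4 * a)⁻¹ * (2 * X + 1), ?_⟩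
    rw [hd, hP]
    linear_combination h4
  have hpP2 : ¬ p ^ 2 ∣ P := by
    intro h
    have hsq : Squarefree P := Polynomial.Separable.squarefree hsep
    exact hp.not_isUnit (hsq p (by rwa [← sq]))
  have hf : poly l a = C Q * X ^ l - C P := rfl
  have hcoeff : ∀ n, (poly l a).coeff n = (if n = l then Q else 0) - (if n = 0 then P else 0) := by
    intro n
    rw [hf, coeff_sub, coeff_C_mul, coeff_X_pow, coeff_C]
    simp
  have hnd : (poly l a).natDegree = l := by
    apply natDegree_eq_of_le_of_coeff_ne_zero
    · rw [natDegree_le_iff_coeff_eq_zero]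
      intro n hn
      rw [hcoeff, if_neg (by omega), if_neg (by omega), sub_zero]
    · rw [hcoeff, if_pos rfl, if_neg hl, sub_zero]
      exact hlead
  have hprime : (Ideal.span {p}).IsPrime :=
    (Ideal.span_singleton_prime hp.ne_zero).2 hp.prime
  refine Polynomial.IsEisensteinAt.irreducible (𝓟 := Ideal.span {p}) ⟨?_, ?_, ?_⟩ hprime ?_ ?_
  · rw [leadingCoeff, hnd, hcoeff, if_pos rfl, if_neg hl, sub_zero, Ideal.mem_span_singleton]
    exact hpQ
  · intro n hn
    rw [hnd] at hn
    rw [hcoeff, if_neg (by omega), Ideal.mem_span_singleton, zero_sub, dvd_neg]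
    split_ifs
    · exact hpP
    · exact dvd_zero p
  · rw [hcoeff, if_neg (Ne.symm hl), if_pos rfl, zero_sub, Ideal.span_singleton_pow,
      Ideal.mem_span_singleton, dvd_neg]
    exact hpP2
  · intro r hr
    rw [C_dvd_iff_dvd_coeff] at hr
    have h0 := hr 0
    have h1 := hr l
    rw [hcoeff, if_neg (Ne.symm hl), if_pos rfl, zero_sub, dvd_neg] at h0
    rw [hcoeff, if_pos rfl, if_neg hl, sub_zero] at h1
    exact hcop.isUnit_of_dvd' h0 h1
  · omega

/-- The parameter `b` of the hyperelliptic models, in terms of `a`. -/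
def paramB (a : K) : K := 2 * (1 + 4 * a) / (1 - 4 * a)

/-- `z ^ (2 l) + b z ^ l + 1`. -/
def modelY (l : ℕ) (b : K) : K[X] := X ^ (2 * l) + C b * X ^ l + 1

/-- `(w + 2) (w g(w ^ 2 - 2) + b)`, where `g` is the minimal polynomial over `ℚ` of
`-ζ - ζ⁻¹`. -/
def modelX [CharZero K] (ζ : ℂ) (b : K) : K[X] :=
  (X + 2) * (X * ((minpoly ℚ (-ζ - ζ⁻¹)).map (algebraMap ℚ K)).comp (X ^ 2 - 2) + C b)

end DihedralCover

end

/-! With `T = t^l`, the equation of `Y` is the quadratic `(T-1)x² - (T+1)x + (T-1)a = 0` in `x`. Its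
discriminant is `(T+1)² - 4a(T-1)² = (1-4a)(T² + bT + 1)`, so the square root `y = 2(T-1)x - (T+1)`
replaces `x` as a generator and gives the model of `Y` (`isQuadraticModel_modelY`). That model is
palindromic, so `(t, y) ↦ (1/t, y/t^l)` preserves it; this automorphism sends `x` to `-x` and is `α`
(`exists_involution`).

Put `w = t + 1/t` and `μ = y(t+1)/t^m` with `2m = l+1`. Both are fixed by `α`, they generate the
fixed field (`fixedField_eq_adjoin`), and `μ² = (1-4a)(w+2)(t^l + t^(-l) + b)`. Here `t^l + t^(-l)`
is the Chebyshev polynomial `C_l(w)`, equal to `w g_l(w²-2)` by `minpoly_neg_add_inv` and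
`X_mul_oddFactor_comp`.

Both curves thus have the form `y² = h(z)` with `h` separable of even degree `2n`, and everything
else is proved for such fields. Regularity of `f dz/y` at the valuation rings containing `z` forces
`f` into `K[z] + K[z]y`, and the same holds in the chart `(1/z, y/z^n)`. Comparing the charts leaves
`p(z) dz/y` with `deg p ≤ n-2`, whence genus `n-1` (`genus_eq`). Here `n = l` for `Y` and `n =
(l+1)/2` for `X`. -/

noncomputable section

namespace AlgCurve

/-! ### Function fields of curves `y² = h(z)`. -/

section Quadratic

variable {K : Type*} [Field K] {F : Type*} [Field F] [Algebra K F]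

/-- `F` is the function field `K(z, y)` of the curve `y ^ 2 = h(z)`. -/
structure IsQuadraticModel (h : K[X]) (z y : F) : Prop where
  transcendental : Transcendental K z
  sq_eq : y ^ 2 = aeval z h
  adjoin_eq_top : IntermediateField.adjoin K {z, y} = ⊤

namespace IsQuadraticModel

variable {h : K[X]} {z y : F}

theorem aeval_injective (H : IsQuadraticModel h z y) :
    Function.Injective (aeval z : K[X] →ₐ[K] F) :=
  transcendental_iff_injective.1 H.transcendental

theorem aeval_ne_zero (H : IsQuadraticModel h z y) {p : K[X]} (hp : p ≠ 0) : aeval z p ≠ 0 :=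
  fun h0 => hp (H.aeval_injective (by rw [h0, map_zero]))

theorem neg (H : IsQuadraticModel h z y) : IsQuadraticModel h z (-y) := by
  refine ⟨H.transcendental, by rw [neg_sq, H.sq_eq], ?_⟩
  rw [eq_top_iff, ← H.adjoin_eq_top, IntermediateField.adjoin_le_iff]
  rintro w (rfl | rfl)
  · exact IntermediateField.subset_adjoin _ _ (by simp)
  · rw [← neg_neg w]
    exact neg_mem (IntermediateField.subset_adjoin _ _ (by simp))

theorem exists_rep (H : IsQuadraticModel h z y) (f : F) :
    ∃ p q r : K[X], r ≠ 0 ∧ f * aeval z r = aeval z p + aeval z q * y := by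
  have hf : f ∈ IntermediateField.adjoin K {z, y} := by rw [H.adjoin_eq_top]; trivial
  induction hf using IntermediateField.adjoin_induction with
  | mem w hw =>
    rcases hw with rfl | rfl
    · exact ⟨X, 0, 1, one_ne_zero, by simp⟩
    · exact ⟨0, 1, 1, one_ne_zero, by simp⟩
  | algebraMap c => exact ⟨C c, 0, 1, one_ne_zero, by simp⟩
  | add u v _ _ hu hv =>
    obtain ⟨p, q, r, hr, e⟩ := hu
    obtain ⟨p', q', r', hr', e'⟩ := hv
    refine ⟨p * r' + p' * r, q * r' + q' * r, r * r', mul_ne_zero hr hr', ?_⟩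
    simp only [map_add, map_mul]
    linear_combination aeval z r' * e + aeval z r * e'
  | mul u v _ _ hu hv =>
    obtain ⟨p, q, r, hr, e⟩ := hu
    obtain ⟨p', q', r', hr', e'⟩ := hv
    refine ⟨p * p' + q * q' * h, p * q' + q * p', r * r', mul_ne_zero hr hr', ?_⟩
    simp only [map_add, map_mul]
    linear_combination v * aeval z r' * e + (aeval z p + aeval z q * y) * e' +
      aeval z q * aeval z q' * H.sq_eq
  | inv u _ hu =>
    obtain ⟨p, q, r, hr, e⟩ := hu
    rcases eq_or_ne u 0 with rfl | hu0
    · exact ⟨0, 0, 1, one_ne_zero, by simp⟩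
    -- Nothing is assumed on `h`, which may be a square, so the norm can vanish although `p + qy ≠
    -- 0`. Then `p = qy` in `F`, and `u r = 2p` already lies in `K[z]`.
    by_cases hn : p ^ 2 - q ^ 2 * h = 0
    · have hn' : (aeval z p + aeval z q * y) * (aeval z p - aeval z q * y) = 0 := by
        have := congrArg (aeval z) hn
        simp only [map_sub, map_mul, map_pow, map_zero] at this
        linear_combination this - aeval z q ^ 2 * H.sq_eq
      have hne : aeval z p + aeval z q * y ≠ 0 := by
        rw [← e]; exact mul_ne_zero hu0 (H.aeval_ne_zero hr)
      have hpq := (mul_eq_zero.1 hn').resolve_left hne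
      have e2 : u * aeval z r = aeval z (2 * p) := by
        rw [e, map_mul, map_ofNat]; linear_combination -hpq
      refine ⟨r, 0, 2 * p, fun h0 => ?_, ?_⟩
      · rw [h0, map_zero] at e2
        exact mul_ne_zero hu0 (H.aeval_ne_zero hr) e2
      · rw [← e2, map_zero]; field_simp; ring
    · refine ⟨r * p, -(r * q), p ^ 2 - q ^ 2 * h, hn, ?_⟩
      field_simp
      simp only [map_sub, map_mul, map_pow, map_neg]
      linear_combination (-(aeval z p - aeval z q * y)) * e + aeval z q ^ 2 * H.sq_eq

/-- Otherwise `p² = q² h` makes `h` the square of a polynomial, impossible for a squarefree `h` of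
positive degree. -/
theorem eq_zero_of_add_mul_eq_zero (H : IsQuadraticModel h z y) (hh : Squarefree h)
    (hdeg : 0 < h.natDegree) {p q : K[X]} (e : aeval z p + aeval z q * y = 0) :
    p = 0 ∧ q = 0 := by
  have e2 : p ^ 2 = q ^ 2 * h := H.aeval_injective <| by
    simp only [map_mul, map_pow]
    linear_combination (aeval z p - aeval z q * y) * e + aeval z q ^ 2 * H.sq_eq
  by_cases hq : q = 0
  · subst hq; simpa using e2
  exfalso
  obtain ⟨k, rfl⟩ : q ∣ p := (UniqueFactorizationMonoid.pow_dvd_pow_iff_dvd two_ne_zero).1 ⟨h, e2⟩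
  have hk : k * k = h := by
    have : q ^ 2 ≠ 0 := pow_ne_zero _ hq
    apply mul_left_cancel₀ this
    rw [← e2]; ring
  have hu : IsUnit k := hh k ⟨1, by rw [hk, mul_one]⟩
  have := natDegree_eq_zero_of_isUnit (hk ▸ hu.mul hu)
  omega

theorem exists_algEquiv_functionField (H : IsQuadraticModel h z y) (hh : Squarefree h)
    (hdeg : 0 < h.natDegree) :
    ∃ e : PlaneCurve.FunctionField (X ^ 2 - C h : K[X][X]) ≃ₐ[K] F,
      e (PlaneCurve.coordX _) = z ∧ e (PlaneCurve.coordY _) = y := by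
  set f : K[X][X] := X ^ 2 - C h with hf
  have hmonic : f.Monic := monic_X_pow_sub_C h two_ne_zero
  have hfdeg : f.natDegree = 2 := natDegree_X_pow_sub_C
  let φ : PlaneCurve.CoordinateRing f →+* F :=
    AdjoinRoot.lift (aeval z : K[X] →ₐ[K] F).toRingHom y (by simp [hf, H.sq_eq])
  have hφof : ∀ p : K[X], φ (AdjoinRoot.of f p) = aeval z p := fun p => by
    simp [φ]
  have hφroot : φ (AdjoinRoot.root f) = y := by simp [φ]
  have hφinj : Function.Injective φ := by
    rw [injective_iff_map_eq_zero]
    intro a ha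
    obtain ⟨g, rfl⟩ := AdjoinRoot.mk_surjective a
    have hmod : AdjoinRoot.mk f g = AdjoinRoot.mk f (g %ₘ f) := by
      conv_lhs => rw [← modByMonic_add_div g f]
      simp
    have hd : (g %ₘ f).natDegree ≤ 1 := by
      have := natDegree_modByMonic_lt g hmonic (by intro h1; rw [h1] at hfdeg; simp at hfdeg)
      omega
    obtain ⟨q, p, hqp⟩ := exists_eq_X_add_C_of_natDegree_le_one hd
    rw [hmod, hqp] at ha ⊢
    simp only [map_add, map_mul, AdjoinRoot.mk_C, AdjoinRoot.mk_X, hφof, hφroot] at ha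
    obtain ⟨rfl, rfl⟩ := H.eq_zero_of_add_mul_eq_zero hh hdeg (p := p) (q := q) (by rw [← ha]; ring)
    simp
  let _ : Algebra (PlaneCurve.CoordinateRing f) F := φ.toAlgebra
  have : FaithfulSMul (PlaneCurve.CoordinateRing f) F :=
    (faithfulSMul_iff_algebraMap_injective _ _).2 hφinj
  have : IsScalarTower K (PlaneCurve.CoordinateRing f) F := by
    refine IsScalarTower.of_algebraMap_eq fun c => ?_
    have : algebraMap K (PlaneCurve.CoordinateRing f) c = AdjoinRoot.of f (C c) := rfl
    rw [this]
    change _ = φ _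
    rw [hφof, aeval_C]
  have : IsFractionRing (PlaneCurve.CoordinateRing f) F := by
    refine IsFractionRing.of_field _ _ fun w => ?_
    obtain ⟨p, q, r, hr, e⟩ := H.exists_rep w
    refine ⟨AdjoinRoot.of f p + AdjoinRoot.of f q * AdjoinRoot.root f, AdjoinRoot.of f r, ?_⟩
    change _ = φ _ / φ _
    rw [map_add, map_mul, hφof, hφof, hφof, hφroot, ← e,
      mul_div_cancel_right₀ _ (H.aeval_ne_zero hr)]
  refine ⟨(FractionRing.algEquiv (PlaneCurve.CoordinateRing f) F).restrictScalars K, ?_, ?_⟩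
  · simp only [PlaneCurve.coordX, AlgEquiv.restrictScalars_apply, AlgEquiv.commutes]
    change φ _ = _
    rw [hφof, aeval_X]
  · simp only [PlaneCurve.coordY, AlgEquiv.restrictScalars_apply, AlgEquiv.commutes]
    exact hφroot

theorem hasModel (H : IsQuadraticModel h z y) (hh : h.Separable)
    (hdeg : 0 < h.natDegree) : HasModel K F h :=
  ⟨hh, (H.exists_algEquiv_functionField hh.squarefree hdeg).elim fun e _ => ⟨e.symm⟩⟩

/-- This is the source of automorphisms: with `F' = F`, two generating pairs satisfying the same
equation yield the conjugation `y ↦ -y` and, later, the involution `α`. -/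
theorem exists_algEquiv {F' : Type*} [Field F'] [Algebra K F'] {z' y' : F'}
    (H : IsQuadraticModel h z y) (H' : IsQuadraticModel h z' y') (hh : Squarefree h)
    (hdeg : 0 < h.natDegree) : ∃ e : F ≃ₐ[K] F', e z = z' ∧ e y = y' := by
  obtain ⟨e, ez, ey⟩ := H.exists_algEquiv_functionField hh hdeg
  obtain ⟨e', ez', ey'⟩ := H'.exists_algEquiv_functionField hh hdeg
  refine ⟨e.symm.trans e', ?_, ?_⟩
  · rw [AlgEquiv.trans_apply, ← ez, AlgEquiv.symm_apply_apply, ez']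
  · rw [AlgEquiv.trans_apply, ← ey, AlgEquiv.symm_apply_apply, ey']

end IsQuadraticModel

/-! ### The integral closure of `K[z]` in `F`. -/

theorem dvd_of_sq_dvd_sq_mul_squarefree {h q r : K[X]} (hh : Squarefree h) (hr : r ≠ 0)
    (hd : r ^ 2 ∣ q ^ 2 * h) : r ∣ q := by
  classical
  obtain ⟨r', q', e1, e2, hu⟩ := extract_gcd r q
  have hc : IsCoprime r' q' := (gcd_isUnit_iff_isRelPrime.1 hu).isCoprime
  generalize gcd r q = g at e1 e2
  subst e1 e2
  have h1 : r' ^ 2 ∣ q' ^ 2 * h := by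
    rw [mul_pow, mul_pow, mul_assoc] at hd
    exact (mul_dvd_mul_iff_left (pow_ne_zero 2 (left_ne_zero_of_mul hr))).1 hd
  have h2 : r' * r' ∣ h := by
    rw [← sq]
    exact (IsCoprime.pow hc).dvd_of_dvd_mul_left h1
  have h3 : IsUnit r' := hh r' h2
  exact (h3.mul_right_dvd).2 ⟨q', rfl⟩

/-- `K[z]` is a polynomial ring, hence integrally closed, and `f = p/r` lies in its fraction field.
-/
theorem exists_aeval_eq_of_isIntegralElem {z : F} (hz : Transcendental K z) {f : F} {p r : K[X]}
    (hr : r ≠ 0) (e : f * aeval z r = aeval z p)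
    (hf : (aeval z : K[X] →ₐ[K] F).toRingHom.IsIntegralElem f) : ∃ k : K[X], f = aeval z k := by
  have hinj : Function.Injective (aeval z : K[X] →ₐ[K] F) := transcendental_iff_injective.1 hz
  let _ : Algebra K[X] F := (aeval z : K[X] →ₐ[K] F).toRingHom.toAlgebra
  have : FaithfulSMul K[X] F := (faithfulSMul_iff_algebraMap_injective _ _).2 hinj
  let _ : Algebra (FractionRing K[X]) F := FractionRing.liftAlgebra K[X] F
  have hr' : algebraMap K[X] (FractionRing K[X]) r ≠ 0 := by simpa using hr
  have hrF : aeval z r ≠ 0 := fun h0 => hr (hinj (by rw [h0, map_zero]))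
  have hx : algebraMap (FractionRing K[X]) F
      (algebraMap K[X] (FractionRing K[X]) p / algebraMap K[X] (FractionRing K[X]) r) = f := by
    rw [map_div₀, ← IsScalarTower.algebraMap_apply, ← IsScalarTower.algebraMap_apply]
    change aeval z p / aeval z r = f
    rw [← e, mul_div_cancel_right₀ _ hrF]
  have hint : IsIntegral K[X]
      (algebraMap K[X] (FractionRing K[X]) p / algebraMap K[X] (FractionRing K[X]) r) := by
    rw [← isIntegral_algebraMap_iff (algebraMap (FractionRing K[X]) F).injective, hx]
    exact hf
  obtain ⟨k, hk⟩ := IsIntegrallyClosed.isIntegral_iff.1 hint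
  refine ⟨k, ?_⟩
  rw [← hx, ← hk, ← IsScalarTower.algebraMap_apply]
  rfl

namespace IsQuadraticModel

variable {h : K[X]} {z y : F}

theorem y_ne_zero (H : IsQuadraticModel h z y) (hh : h ≠ 0) : y ≠ 0 := by
  rintro rfl
  exact H.aeval_ne_zero hh (by rw [← H.sq_eq]; simp)

/-- With `σ` the conjugation `y ↦ -y`, both `f + σf` and `(f - σf)²` are integral and lie in `K(z)`,
hence in `K[z]`. If `f = (p + qy)/r`, the second gives `r² ∣ (2q)² h`, and squarefreeness of `h`
then gives `r ∣ 2q`. -/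
theorem exists_eq_of_isIntegralElem [CharZero K] (H : IsQuadraticModel h z y) (hh : Squarefree h)
    (hdeg : 0 < h.natDegree) {f : F}
    (hf : (aeval z : K[X] →ₐ[K] F).toRingHom.IsIntegralElem f) :
    ∃ p q : K[X], f = aeval z p + aeval z q * y := by
  obtain ⟨σ, σz, σy⟩ := H.exists_algEquiv H.neg hh hdeg
  obtain ⟨p, q, r, hr, e⟩ := H.exists_rep f
  have : CharZero F := charZero_of_injective_algebraMap (algebraMap K F).injective
  have hσ : ∀ k : K[X], σ (aeval z k) = aeval z k := fun k => by
    rw [← aeval_algHom_apply, σz]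
  have e' : σ f * aeval z r = aeval z p - aeval z q * y := by
    have := congrArg σ e
    simp only [map_mul, map_add, hσ, σy] at this
    rw [this]; ring
  have hrF := H.aeval_ne_zero hr
  have hσf : (aeval z : K[X] →ₐ[K] F).toRingHom.IsIntegralElem (σ f) := by
    obtain ⟨P, hP, hP0⟩ := hf
    refine ⟨P, hP, ?_⟩
    have := congrArg σ.toRingEquiv.toRingHom hP0
    rw [map_zero, hom_eval₂] at this
    convert! this using 2
    ext k
    · simp
    · simp [σz]
  have e2 : (f - σ f) * aeval z r = 2 * aeval z q * y := by
    rw [sub_mul, e, e']; ring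
  have e3 : (f - σ f) ^ 2 * aeval z (r ^ 2) = aeval z ((2 * q) ^ 2 * h) := by
    simp only [map_mul, map_pow, map_ofNat]
    rw [← mul_pow, e2, ← H.sq_eq]; ring
  obtain ⟨k, hk⟩ := exists_aeval_eq_of_isIntegralElem H.transcendental (f := f + σ f) (p := 2 * p)
    hr (by rw [add_mul, e, e', map_mul, map_ofNat]; ring) (RingHom.IsIntegralElem.add _ hf hσf)
  have hd := RingHom.IsIntegralElem.sub _ hf hσf
  obtain ⟨m, hm⟩ := exists_aeval_eq_of_isIntegralElem H.transcendental (pow_ne_zero 2 hr) e3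
    (by rw [sq]; exact RingHom.IsIntegralElem.mul _ hd hd)
  have hmr : m * r ^ 2 = (2 * q) ^ 2 * h := H.aeval_injective <| by
    rw [← e3, map_mul, hm]
  obtain ⟨s, hs⟩ := dvd_of_sq_dvd_sq_mul_squarefree hh hr (Dvd.intro_left _ hmr)
  have hs' : 2 * aeval z q = aeval z r * aeval z s := by
    have := congrArg (aeval z) hs
    simpa only [map_mul, map_ofNat] using this
  refine ⟨C 2⁻¹ * k, C 2⁻¹ * s, ?_⟩
  simp only [map_mul, aeval_C, map_inv₀, map_ofNat, ← hk]
  apply mul_right_cancel₀ hrF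
  linear_combination (1 / 2) * e2 + (1 / 2) * hs' * y

/-! ### The differential `dz/y` as a generator of `Ω[F⁄K]`. -/

section Differential

/-- The differential `dz / y`. -/
def diff (K : Type*) [Field K] {F : Type*} [Field F] [Algebra K F] (z y : F) : Ω[F⁄K] :=
  y⁻¹ • KaehlerDifferential.D K F z

theorem D_z (hy : y ≠ 0) : KaehlerDifferential.D K F z = y • diff K z y := by
  rw [diff, smul_smul, mul_inv_cancel₀ hy, one_smul]

theorem two_smul_D_y (H : IsQuadraticModel h z y) (hy : y ≠ 0) :
    (2 : F) • KaehlerDifferential.D K F y = aeval z (derivative h) • diff K z y := by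
  have e := congrArg (KaehlerDifferential.D K F) H.sq_eq
  rw [Derivation.map_aeval, Derivation.leibniz_pow, pow_one, ← Nat.cast_smul_eq_nsmul F,
    Nat.cast_ofNat] at e
  rw [diff, smul_comm, ← e, smul_smul, smul_smul]
  congr 1
  field_simp

/-- The coefficient of `dz/y` is again in `K[z] + K[z]y`: `dz/y` generates the differentials of the
affine chart without denominators. -/
theorem D_aeval_add_mul [CharZero K] (H : IsQuadraticModel h z y) (hy : y ≠ 0) (p q : K[X]) :
    KaehlerDifferential.D K F (aeval z p + aeval z q * y) =
      (aeval z (derivative q * h + C 2⁻¹ * q * derivative h) +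
        aeval z (derivative p) * y) • diff K z y := by
  have : CharZero F := charZero_of_injective_algebraMap (algebraMap K F).injective
  have hDy : KaehlerDifferential.D K F y = (2⁻¹ * aeval z (derivative h)) • diff K z y := by
    rw [mul_smul, ← H.two_smul_D_y hy, smul_smul, inv_mul_cancel₀ two_ne_zero, one_smul]
  rw [map_add, Derivation.leibniz, Derivation.map_aeval, Derivation.map_aeval, hDy, D_z hy]
  simp only [smul_smul, ← add_smul]
  congr 1
  simp only [map_add, map_mul, aeval_C, map_inv₀, map_ofNat, ← H.sq_eq]
  ring

/-- If `dz = 0`, then every differential vanishes, so the finitely generated extension `F/K` is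
unramified, hence algebraic, contrary to the transcendence of `z`. -/
theorem D_z_ne_zero [CharZero K] (H : IsQuadraticModel h z y) (hh : h ≠ 0) :
    KaehlerDifferential.D K F z ≠ 0 := by
  intro h0
  have hy := H.y_ne_zero hh
  have hη : diff K z y = 0 := by rw [diff, h0, smul_zero]
  have : CharZero F := charZero_of_injective_algebraMap (algebraMap K F).injective
  have hD : ∀ f : F, KaehlerDifferential.D K F f = 0 := fun f => by
    obtain ⟨p, q, r, hr, e⟩ := H.exists_rep f
    have e' := congrArg (KaehlerDifferential.D K F) e
    rw [H.D_aeval_add_mul hy, hη, smul_zero, Derivation.leibniz, Derivation.map_aeval, h0,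
      smul_zero, smul_zero, zero_add] at e'
    exact (smul_eq_zero.1 e').resolve_left (H.aeval_ne_zero hr)
  have hsub : Subsingleton (Ω[F⁄K]) := by
    rw [← Submodule.subsingleton_iff F, ← subsingleton_iff_bot_eq_top,
      ← KaehlerDifferential.span_range_derivation, eq_comm, Submodule.span_eq_bot]
    rintro _ ⟨f, rfl⟩
    exact hD f
  have : Algebra.FormallyUnramified K F := ⟨hsub⟩
  have : Algebra.EssFiniteType K F :=
    IntermediateField.fg_top_iff.1 <| by
      classical exact ⟨({z, y} : Finset F), by simpa using H.adjoin_eq_top⟩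
  have := Algebra.FormallyUnramified.isSeparable K F
  exact H.transcendental (Algebra.IsAlgebraic.isAlgebraic z)

theorem exists_eq_smul_diff [CharZero K] (H : IsQuadraticModel h z y) (hh : h ≠ 0)
    (ω : Ω[F⁄K]) : ∃ f : F, ω = f • diff K z y := by
  have hy := H.y_ne_zero hh
  have hω : ω ∈ Submodule.span F (Set.range (KaehlerDifferential.D K F)) := by
    rw [KaehlerDifferential.span_range_derivation]; trivial
  have hle : Submodule.span F (Set.range (KaehlerDifferential.D K F)) ≤
      Submodule.span F {diff K z y} := by
    rw [Submodule.span_le]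
    rintro _ ⟨f, rfl⟩
    rw [SetLike.mem_coe, Submodule.mem_span_singleton]
    obtain ⟨p, q, r, hr, e⟩ := H.exists_rep f
    have hrF := H.aeval_ne_zero hr
    have e' := congrArg (KaehlerDifferential.D K F) e
    rw [H.D_aeval_add_mul hy, Derivation.leibniz, Derivation.map_aeval, D_z hy, smul_smul,
      smul_smul, ← eq_sub_iff_add_eq', ← sub_smul] at e'
    rw [← eq_inv_smul_iff₀ hrF, smul_smul] at e'
    exact ⟨_, e'.symm⟩
  obtain ⟨f, hf⟩ := Submodule.mem_span_singleton.1 (hle hω)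
  exact ⟨f, hf.symm⟩

end Differential

end IsQuadraticModel

/-! ### Valuation rings, the chart at infinity and regular differentials. -/

theorem aeval_mem_valuationSubring {O : ValuationSubring F} (hO : ∀ c : K, algebraMap K F c ∈ O)
    {w : F} (hw : w ∈ O) (p : K[X]) : aeval w p ∈ O := by
  rw [aeval_eq_sum_range]
  refine sum_mem fun i _ => ?_
  rw [Algebra.smul_def]
  exact mul_mem (hO _) (pow_mem hw i)

theorem mem_valuationSubring_of_sq_mem {O : ValuationSubring F} {w : F} (hw : w ^ 2 ∈ O) :
    w ∈ O := by
  rcases O.mem_or_inv_mem w with h | h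
  · exact h
  · rcases eq_or_ne w 0 with rfl | h0
    · exact zero_mem _
    · have := mul_mem hw h
      rwa [sq, mul_assoc, mul_inv_cancel₀ h0, mul_one] at this

theorem aeval_inv_reflect {z : F} (hz : z ≠ 0) {p : K[X]} {N : ℕ} (hN : p.natDegree ≤ N) :
    aeval z⁻¹ (reflect N p) = aeval z p * z⁻¹ ^ N := by
  let _ := invertibleOfNonzero hz
  have := eval₂_reflect_mul_pow (algebraMap K F) z N p hN
  rw [invOf_eq_inv] at this
  rw [aeval_def, aeval_def, ← this, mul_assoc, ← mul_pow, mul_inv_cancel₀ hz, one_pow, mul_one]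

theorem natTrailingDegree_le_one_of_squarefree {h : K[X]} (hh : Squarefree h) :
    h.natTrailingDegree ≤ 1 := by
  by_contra hlt
  have hd : X * X ∣ h := by
    rw [← sq, X_pow_dvd_iff]
    intro d hd
    exact coeff_eq_zero_of_lt_natTrailingDegree (by omega)
  exact not_isUnit_X (hh X hd)

/-- A repeated factor `k` of the reversal has nonzero constant term, because the reversal has
constant term the leading coefficient of `h`. So `k.reverse` has the degree of `k`, and its square
divides `h`. -/
theorem squarefree_reverse {h : K[X]} (hh : Squarefree h) : Squarefree h.reverse := by
  have h0 : h ≠ 0 := hh.ne_zero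
  intro k hk
  have hk0 : k.coeff 0 ≠ 0 := by
    obtain ⟨m, hm⟩ := hk
    intro hk0
    have := congrArg (fun p : K[X] => p.coeff 0) hm
    simp only [coeff_zero_reverse, mul_coeff_zero, hk0, zero_mul] at this
    exact h0 (leadingCoeff_eq_zero.1 this)
  have hkk : k.reverse * k.reverse ∣ h := by
    obtain ⟨m, hm⟩ := hk
    have hr0 : h.reverse ≠ 0 := by rwa [Ne, reverse_eq_zero]
    rw [hm] at hr0
    have hd := natDegree_mul (left_ne_zero_of_mul hr0) (right_ne_zero_of_mul hr0)
    rw [← hm] at hd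
    have hd' := reverse_natDegree_le h
    -- The reversal loses degree when `X ∣ h`, so it is reflected back at the degree of `h` and not
    -- at its own.
    have h2 : h = reflect ((k * k).natDegree + (h.natDegree - (k * k).natDegree)) h.reverse := by
      rw [Nat.add_sub_cancel' (by omega), reverse, reflect_reflect]
    rw [hm, reflect_mul _ _ le_rfl (by omega)] at h2
    exact ⟨_, h2.trans (by rw [← reverse, reverse_mul_of_domain])⟩
  have hu := natDegree_eq_zero_of_isUnit (hh _ hkk)
  rw [reverse_natDegree, natTrailingDegree_eq_zero.2 (Or.inr hk0), Nat.sub_zero,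
    natDegree_eq_zero] at hu
  obtain ⟨c, rfl⟩ := hu
  rw [coeff_C_zero] at hk0
  exact isUnit_C.2 hk0.isUnit

namespace IsQuadraticModel

variable {h : K[X]} {z y : F}

theorem z_ne_zero (H : IsQuadraticModel h z y) : z ≠ 0 := by
  have := H.aeval_ne_zero (p := X) X_ne_zero
  rwa [aeval_X] at this

theorem inv (H : IsQuadraticModel h z y) {n : ℕ} (hn : h.natDegree = 2 * n) :
    IsQuadraticModel h.reverse z⁻¹ (y * z⁻¹ ^ n) := by
  have hz := H.z_ne_zero
  refine ⟨fun h0 => H.transcendental (by simpa using h0.inv), ?_, ?_⟩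
  · rw [reverse, aeval_inv_reflect hz le_rfl, mul_pow, H.sq_eq, ← pow_mul, hn, mul_comm n]
  · rw [eq_top_iff, ← H.adjoin_eq_top, IntermediateField.adjoin_le_iff]
    have h1 : z⁻¹ ∈ IntermediateField.adjoin K {z⁻¹, y * z⁻¹ ^ n} :=
      IntermediateField.subset_adjoin _ _ (by simp)
    have h2 : y * z⁻¹ ^ n ∈ IntermediateField.adjoin K {z⁻¹, y * z⁻¹ ^ n} :=
      IntermediateField.subset_adjoin _ _ (by simp)
    have hz' : z ∈ IntermediateField.adjoin K {z⁻¹, y * z⁻¹ ^ n} := by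
      have := inv_mem h1
      rwa [inv_inv] at this
    rintro w (rfl | rfl)
    · exact hz'
    · have := mul_mem h2 (pow_mem hz' n)
      rwa [mul_assoc, ← mul_pow, inv_mul_cancel₀ hz, one_pow, mul_one] at this

/-- The power `n - 2` is the order of vanishing of `dz/y` along `1/z = 0` relative to the
differential of the other chart; it becomes the degree bound in the genus computation. -/
theorem diff_inv (H : IsQuadraticModel h z y) {n : ℕ} (hn : 2 ≤ n) :
    diff K z y = (-z⁻¹ ^ (n - 2)) • diff K z⁻¹ (y * z⁻¹ ^ n) := by
  have hz := H.z_ne_zero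
  obtain ⟨m, rfl⟩ := Nat.exists_eq_add_of_le hn
  rw [diff, diff, Derivation.leibniz_inv, smul_smul, smul_smul]
  congr 1
  rw [Nat.add_sub_cancel_left, mul_inv, inv_pow, inv_pow, inv_pow, inv_inv]
  field_simp
  ring

/-- A function whose expansions on the two affine charts of the curve have a bounded pole at
infinity is a polynomial in `z` of bounded degree. -/
theorem eq_zero_and_natDegree_le (H : IsQuadraticModel h z y) (hh : Squarefree h)
    (hdeg : 0 < h.natDegree) {n k : ℕ} (hk : k < n) {p q p' q' : K[X]}
    (e : (aeval z p + aeval z q * y) * z⁻¹ ^ k =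
      aeval z⁻¹ p' + aeval z⁻¹ q' * (y * z⁻¹ ^ n)) : q = 0 ∧ p.natDegree ≤ k := by
  have hz := H.z_ne_zero
  set N := max p'.natDegree q'.natDegree with hN
  have hr : ∀ r : K[X], r.natDegree ≤ N → aeval z⁻¹ r = aeval z (reflect N r) * z⁻¹ ^ N := by
    intro r hr
    have := aeval_inv_reflect (inv_ne_zero hz) hr
    rw [inv_inv] at this
    rw [this, mul_assoc, ← mul_pow, mul_inv_cancel₀ hz, one_pow, mul_one]
  have hrd : ∀ r : K[X], r.natDegree ≤ N → (reflect N r).natDegree ≤ N := fun r hr =>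
    natDegree_reflect_le.trans (by omega)
  have hp'N : p'.natDegree ≤ N := le_max_left _ _
  have hq'N : q'.natDegree ≤ N := le_max_right _ _
  rw [hr p' hp'N, hr q' hq'N] at e
  obtain ⟨m, rfl⟩ := Nat.exists_eq_add_of_lt hk
  have e2 : aeval z (p * X ^ (N + m + 1) - X ^ (k + m + 1) * reflect N p') +
      aeval z (q * X ^ (N + m + 1) - reflect N q') * y = 0 := by
    simp only [map_sub, map_mul, map_pow, aeval_X]
    simp only [inv_pow] at e
    field_simp at e
    apply mul_left_cancel₀ (pow_ne_zero k hz)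
    linear_combination e
  obtain ⟨e3, e4⟩ := H.eq_zero_of_add_mul_eq_zero hh hdeg e2
  rw [sub_eq_zero] at e3 e4
  constructor
  · by_contra hq
    have := congrArg natDegree e4
    rw [natDegree_mul_X_pow _ hq] at this
    have := hrd q' hq'N
    omega
  · rcases eq_or_ne p 0 with rfl | hp
    · simp
    have h5 := congrArg natDegree e3
    rw [natDegree_mul_X_pow _ hp] at h5
    have h6 := hrd p' hp'N
    have h7 := natDegree_mul_le (p := (X : K[X]) ^ (k + m + 1)) (q := reflect N p')
    rw [natDegree_X_pow] at h7
    omega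

/-- Since `h dz/y = y dz` and `h' dz/y = 2 dy`, a Bézout relation `a h + b h' = 1` gives `dz/y = a y
dz + 2 b dy`, which is visibly regular wherever `z` is. -/
theorem smul_diff_mem_regularDifferentialsAt (H : IsQuadraticModel h z y) (hh : h.Separable)
    (hy : y ≠ 0) {O : ValuationSubring F} (hO : ∀ c : K, algebraMap K F c ∈ O) (hz : z ∈ O)
    {f : F} (hf : f ∈ O) : f • diff K z y ∈ regularDifferentialsAt K F O := by
  obtain ⟨a, b, hab⟩ := hh
  have hyO : y ∈ O := mem_valuationSubring_of_sq_mem (by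
    rw [H.sq_eq]; exact aeval_mem_valuationSubring hO hz h)
  have e : f • diff K z y = (f * (aeval z a * y)) • KaehlerDifferential.D K F z +
      (f * (2 * aeval z b)) • KaehlerDifferential.D K F y := by
    have h1 := congrArg (aeval z) hab
    rw [map_add, map_mul, map_mul, map_one, ← H.sq_eq] at h1
    rw [D_z hy, mul_comm 2 (aeval z b), ← mul_assoc f (aeval z b), mul_smul _ (2 : F), H.two_smul_D_y hy, smul_smul,
      smul_smul, ← add_smul]
    congr 1
    linear_combination (-f) * h1
  rw [e]
  have h2 : (2 : F) ∈ O := by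
    have := hO 2
    rwa [map_ofNat] at this
  refine add_mem (Submodule.subset_span ⟨_, mul_mem hf (mul_mem ?_ hyO), z, hz, rfl⟩)
    (Submodule.subset_span ⟨_, mul_mem hf (mul_mem h2 ?_), y, hyO, rfl⟩)
  · exact aeval_mem_valuationSubring hO hz a
  · exact aeval_mem_valuationSubring hO hz b

/-- The integral closure `B` of `K[z]` is a Dedekind domain with `dB ⊆ B dz/y`. By the quotient
rule, `dO ⊆ O dz/y` for each localization `O` at a maximal ideal. Regularity at `O` then forces `f ∈
O`, and the intersection of these rings is `B`. -/
theorem isIntegralElem_of_mem_regularDifferentialsAt [CharZero K] (H : IsQuadraticModel h z y)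
    (hh : Squarefree h) (hdeg : 0 < h.natDegree) {f : F}
    (hf : ∀ O : ValuationSubring F, (∀ c : K, algebraMap K F c ∈ O) → z ∈ O →
      f • diff K z y ∈ regularDifferentialsAt K F O) :
    (aeval z : K[X] →ₐ[K] F).toRingHom.IsIntegralElem f := by
  have hy := H.y_ne_zero hh.ne_zero
  have hη : diff K z y ≠ 0 := smul_ne_zero (inv_ne_zero hy) (H.D_z_ne_zero hh.ne_zero)
  let _ : Algebra K[X] F := (aeval z : K[X] →ₐ[K] F).toRingHom.toAlgebra
  have hmap : ∀ p : K[X], algebraMap K[X] F p = aeval z p := fun _ => rfl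
  have : FaithfulSMul K[X] F := (faithfulSMul_iff_algebraMap_injective _ _).2 H.aeval_injective
  let _ : Algebra (FractionRing K[X]) F := FractionRing.liftAlgebra K[X] F
  have : CharZero (FractionRing K[X]) := charZero_of_injective_algebraMap
    (IsFractionRing.injective K[X] (FractionRing K[X]))
  have hmap' : ∀ p : K[X], algebraMap (FractionRing K[X]) F (algebraMap K[X] _ p) = aeval z p :=
    fun p => by rw [← IsScalarTower.algebraMap_apply]; rfl
  have : FiniteDimensional (FractionRing K[X]) F := by
    classical
    refine ⟨⟨{1, y}, ?_⟩⟩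
    rw [eq_top_iff]
    intro w _
    obtain ⟨p, q, r, hr, e⟩ := H.exists_rep w
    have hrF := H.aeval_ne_zero hr
    rw [Finset.coe_pair, Submodule.mem_span_pair]
    refine ⟨algebraMap K[X] _ p / algebraMap K[X] _ r, algebraMap K[X] _ q / algebraMap K[X] _ r,
      ?_⟩
    rw [Algebra.smul_def, Algebra.smul_def, map_div₀, map_div₀, hmap', hmap', hmap']
    field_simp
    rw [← e, mul_comm]
  have : IsFractionRing (integralClosure K[X] F) F :=
    integralClosure.isFractionRing_of_finite_extension (FractionRing K[X]) F
  have hD : ∀ b : integralClosure K[X] F, ∃ b' : integralClosure K[X] F,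
      KaehlerDifferential.D K F b = (b' : F) • diff K z y := by
    intro b
    obtain ⟨p, q, e⟩ := H.exists_eq_of_isIntegralElem hh hdeg b.2
    have hyi : y ∈ integralClosure K[X] F := by
      refine IsIntegral.of_pow two_pos ?_
      rw [H.sq_eq, ← hmap]
      exact isIntegral_algebraMap
    refine ⟨⟨_, add_mem (Subalgebra.algebraMap_mem _ (derivative q * h + C 2⁻¹ * q * derivative h))
      (mul_mem (Subalgebra.algebraMap_mem _ (derivative p)) hyi)⟩, ?_⟩
    rw [e, H.D_aeval_add_mul hy]
    rfl
  have hmem : f ∈ (algebraMap (integralClosure K[X] F) F).range := by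
    refine IsDedekindDomain.HeightOneSpectrum.mem_integers_of_valuation_le_one F f fun v => ?_
    have hBO : ∀ b : integralClosure K[X] F, (b : F) ∈ (v.valuation F).valuationSubring :=
      fun b => v.valuation_le_one b
    have hKO : ∀ c : K, algebraMap K F c ∈ (v.valuation F).valuationSubring := fun c => by
      have := hBO (algebraMap K[X] _ (C c))
      rwa [Subalgebra.coe_algebraMap, hmap, aeval_C] at this
    have hzO : z ∈ (v.valuation F).valuationSubring := by
      have := hBO (algebraMap K[X] _ X)
      rwa [Subalgebra.coe_algebraMap, hmap, aeval_X] at this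
    have hDO : ∀ g ∈ (v.valuation F).valuationSubring, ∃ g' ∈ (v.valuation F).valuationSubring,
        KaehlerDifferential.D K F g = g' • diff K z y := by
      intro g hg
      -- Here `g = n/d` with `n, d ∈ B` and `d` a unit at `v`, so the quotient rule introduces no
      -- pole.
      obtain ⟨n, d, hd⟩ := v.exists_primeCompl_mul_eq_of_integer g hg
      obtain ⟨n', hn'⟩ := hD n
      obtain ⟨d', hd'⟩ := hD d
      have hdv : v.valuation F (d : integralClosure K[X] F) = 1 :=
        v.valuation_eq_one_iff_notMem.2 d.2
      have hd0 : ((d : integralClosure K[X] F) : F) ≠ 0 := fun h0 => by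
        rw [h0, map_zero] at hdv; exact zero_ne_one hdv
      have hdinv : ((d : integralClosure K[X] F) : F)⁻¹ ∈ (v.valuation F).valuationSubring := by
        rw [Valuation.mem_valuationSubring_iff, map_inv₀, hdv, inv_one]
      have e := congrArg (KaehlerDifferential.D K F) hd
      change KaehlerDifferential.D K F (g * ((d : integralClosure K[X] F) : F)) =
        KaehlerDifferential.D K F (n : F) at e
      rw [Derivation.leibniz, hn', hd', smul_smul, ← eq_sub_iff_add_eq', ← sub_smul,
        ← eq_inv_smul_iff₀ hd0, smul_smul] at e
      exact ⟨_, mul_mem hdinv (sub_mem (hBO _) (mul_mem hg (hBO _))), e⟩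
    have hle : ∀ ω ∈ regularDifferentialsAt K F (v.valuation F).valuationSubring,
        ∃ c ∈ (v.valuation F).valuationSubring, ω = c • diff K z y := by
      intro ω hω
      induction hω using Submodule.span_induction with
      | mem ω hω =>
        obtain ⟨s, hs, g, hg, rfl⟩ := hω
        obtain ⟨g', hg', e⟩ := hDO g hg
        exact ⟨s * g', mul_mem hs hg', by rw [e, smul_smul]⟩
      | zero => exact ⟨0, zero_mem _, by rw [zero_smul]⟩
      | add ω₁ ω₂ _ _ h₁ h₂ =>
        obtain ⟨c, hc, rfl⟩ := h₁
        obtain ⟨c', hc', rfl⟩ := h₂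
        exact ⟨_, add_mem hc hc', by rw [add_smul]⟩
      | smul k ω _ h₁ =>
        obtain ⟨c, hc, rfl⟩ := h₁
        exact ⟨_, mul_mem (hKO k) hc, by rw [mul_smul, algebraMap_smul]⟩
    obtain ⟨c, hc, e⟩ := hle _ (hf _ hKO hzO)
    rw [smul_left_injective F hη e]
    exact hc
  obtain ⟨b, rfl⟩ := hmem
  exact b.2

end IsQuadraticModel

theorem isIntegralElem_aeval_of_isIntegral (z : F) {f : F} (hf : IsIntegral K f) :
    (aeval z : K[X] →ₐ[K] F).toRingHom.IsIntegralElem f := by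
  obtain ⟨P, hP, hP0⟩ := hf
  refine ⟨P.map C, hP.map C, ?_⟩
  rw [eval₂_map, ← hP0]
  congr 1
  ext c
  simp

/-! ### Genus, field of constants and degree over the line. -/

namespace IsQuadraticModel

variable {h : K[X]} {z y : F}

theorem inv_natDegree_pos (hh : Squarefree h) {n : ℕ} (hn0 : 0 < n) (hn : h.natDegree = 2 * n) :
    0 < h.reverse.natDegree := by
  have := natTrailingDegree_le_one_of_squarefree hh
  rw [reverse_natDegree]
  omega

theorem genus_eq [CharZero K] (H : IsQuadraticModel h z y) (hsep : h.Separable) {n : ℕ}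
    (hn2 : 2 ≤ n) (hn : h.natDegree = 2 * n) : genus K F = n - 1 := by
  have hh := hsep.squarefree
  have hdeg : 0 < h.natDegree := by omega
  have hy := H.y_ne_zero hh.ne_zero
  have hz := H.z_ne_zero
  have H' := H.inv hn
  have hh' := squarefree_reverse hh
  have hsep' : h.reverse.Separable := PerfectField.separable_iff_squarefree.2 hh'
  have hdeg' := inv_natDegree_pos hh (by omega) hn
  have hy' := H'.y_ne_zero hh'.ne_zero
  have hη : diff K z y ≠ 0 := smul_ne_zero (inv_ne_zero hy) (H.D_z_ne_zero hh.ne_zero)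
  let φ : K[X] →ₗ[K] Ω[F⁄K] :=
    ((LinearMap.toSpanSingleton F (Ω[F⁄K]) (diff K z y)).restrictScalars K) ∘ₗ
      (aeval z : K[X] →ₐ[K] F).toLinearMap
  have hφ : ∀ p, φ p = aeval z p • diff K z y := fun _ => rfl
  have hφinj : Function.Injective φ := fun p q hpq =>
    H.aeval_injective (smul_left_injective F hη hpq)
  have hdiff : ∀ f : F, f • diff K z y =
      (-(f * z⁻¹ ^ (n - 2))) • diff K z⁻¹ (y * z⁻¹ ^ n) := fun f => by
    rw [H.diff_inv hn2, smul_smul, mul_neg]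
  -- Every valuation ring contains `z` or `1/z`, so the two charts cover the curve.
  have hreg : regularDifferentials K F = (degreeLT K (n - 1)).map φ := by
    apply le_antisymm
    · intro ω hω
      simp only [regularDifferentials, Submodule.mem_iInf] at hω
      obtain ⟨f, rfl⟩ := H.exists_eq_smul_diff hh.ne_zero ω
      obtain ⟨p, q, e⟩ := H.exists_eq_of_isIntegralElem hh hdeg
        (H.isIntegralElem_of_mem_regularDifferentialsAt hh hdeg fun O hO _ => hω O hO)
      obtain ⟨p', q', e'⟩ := H'.exists_eq_of_isIntegralElem hh' hdeg'
        (H'.isIntegralElem_of_mem_regularDifferentialsAt hh' hdeg' fun O hO _ => by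
          rw [← hdiff f]; exact hω O hO)
      obtain ⟨rfl, hp⟩ := H.eq_zero_and_natDegree_le hh hdeg (n := n) (k := n - 2) (by omega)
        (p := p) (q := q) (p' := -p') (q' := -q') (by
          rw [← e, map_neg, map_neg]; linear_combination -e')
      refine ⟨p, ?_, by rw [hφ, e, map_zero, zero_mul, add_zero]⟩
      rw [SetLike.mem_coe, mem_degreeLT]
      exact degree_le_natDegree.trans_lt (by exact_mod_cast (by omega))
    · rintro _ ⟨p, hp, rfl⟩
      rw [SetLike.mem_coe, mem_degreeLT] at hp
      have hp' : p.natDegree ≤ n - 2 := by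
        by_cases hp0 : p = 0
        · simp [hp0]
        · have := (natDegree_lt_iff_degree_lt hp0).2 hp
          omega
      simp only [regularDifferentials, Submodule.mem_iInf]
      intro O hO
      rw [hφ]
      rcases O.mem_or_inv_mem z with hzO | hzO
      · exact H.smul_diff_mem_regularDifferentialsAt hsep hy hO hzO
          (aeval_mem_valuationSubring hO hzO p)
      · rw [hdiff]
        refine H'.smul_diff_mem_regularDifferentialsAt hsep' hy' hO hzO ?_
        rw [← aeval_inv_reflect hz hp']
        exact neg_mem (aeval_mem_valuationSubring hO hzO _)
  rw [genus, hreg, ← (Submodule.equivMapOfInjective φ hφinj _).finrank_eq,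
    (degreeLTEquiv K (n - 1)).finrank_eq, Module.finrank_fin_fun]

/-- A constant is integral over both `K[z]` and `K[1/z]`; comparing the charts with `k = 0` leaves a
polynomial of degree zero. -/
theorem algebraicClosure_eq_bot [CharZero K] (H : IsQuadraticModel h z y) (hh : Squarefree h)
    {n : ℕ} (hn0 : 0 < n) (hn : h.natDegree = 2 * n) : algebraicClosure K F = ⊥ := by
  rw [eq_bot_iff]
  intro f hf
  have hf : IsIntegral K f := (mem_algebraicClosure_iff.1 hf).isIntegral
  obtain ⟨p, q, e⟩ := H.exists_eq_of_isIntegralElem hh (by omega)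
    (isIntegralElem_aeval_of_isIntegral z hf)
  obtain ⟨p', q', e'⟩ := (H.inv hn).exists_eq_of_isIntegralElem (squarefree_reverse hh)
    (inv_natDegree_pos hh hn0 hn) (isIntegralElem_aeval_of_isIntegral z⁻¹ hf)
  obtain ⟨rfl, hp⟩ := H.eq_zero_and_natDegree_le hh (by omega) (n := n) (k := 0) hn0
    (p := p) (q := q) (p' := p') (q' := q') (by rw [← e, ← e', pow_zero, mul_one])
  rw [natDegree_le_iff_degree_le] at hp
  rw [eq_C_of_degree_le_zero hp, aeval_C, map_zero, zero_mul, add_zero] at e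
  rw [e]
  exact IntermediateField.algebraMap_mem _ _

theorem finrank_adjoin (H : IsQuadraticModel h z y) (hh : Squarefree h)
    (hdeg : 0 < h.natDegree) : Module.finrank (IntermediateField.adjoin K {z}) F = 2 := by
  have hli : LinearIndependent (IntermediateField.adjoin K {z}) ![(1 : F), y] := by
    rw [LinearIndependent.pair_iff]
    rintro ⟨s, hs⟩ ⟨t, ht⟩ e
    simp only [Algebra.smul_def, IntermediateField.algebraMap_apply, mul_one] at e
    obtain ⟨p, r, rfl⟩ := (IntermediateField.mem_adjoin_simple_iff K s).1 hs
    obtain ⟨q, r', rfl⟩ := (IntermediateField.mem_adjoin_simple_iff K t).1 ht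
    suffices h : aeval z p / aeval z r = 0 ∧ aeval z q / aeval z r' = 0 by
      exact ⟨Subtype.ext h.1, Subtype.ext h.2⟩
    -- `IntermediateField.mem_adjoin_simple_iff` allows a zero denominator, in which case the
    -- quotient is `0` by convention.
    by_cases hr : r = 0
    · subst hr
      rw [map_zero, div_zero, zero_add] at e
      exact ⟨by simp, (mul_eq_zero.1 e).resolve_right (H.y_ne_zero hh.ne_zero)⟩
    by_cases hr' : r' = 0
    · subst hr'
      rw [map_zero, div_zero, zero_mul, add_zero] at e
      exact ⟨e, by simp⟩
    have h1 := H.aeval_ne_zero hr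
    have h2 := H.aeval_ne_zero hr'
    field_simp at e
    obtain ⟨h3, h4⟩ := H.eq_zero_of_add_mul_eq_zero hh hdeg (p := p * r') (q := r * q) (by
      simp only [map_mul]; linear_combination e)
    have h5 := (mul_eq_zero.1 h3).resolve_right hr'
    have h6 := (mul_eq_zero.1 h4).resolve_left hr
    simp [h5, h6]
  have hsp : ⊤ ≤ Submodule.span (IntermediateField.adjoin K {z}) (Set.range ![(1 : F), y]) := by
    intro f _
    obtain ⟨p, q, r, hr, e⟩ := H.exists_rep f
    have h1 := H.aeval_ne_zero hr
    have hm : ∀ k : K[X], aeval z k / aeval z r ∈ IntermediateField.adjoin K {z} := fun k =>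
      (IntermediateField.mem_adjoin_simple_iff K _).2 ⟨k, r, rfl⟩
    rw [Matrix.range_cons, Matrix.range_cons, Matrix.range_empty, Set.union_empty,
      Set.singleton_union, Submodule.mem_span_pair]
    refine ⟨⟨_, hm p⟩, ⟨_, hm q⟩, ?_⟩
    simp only [Algebra.smul_def, IntermediateField.algebraMap_apply, mul_one]
    field_simp
    rw [← e, mul_comm]
  rw [Module.finrank_eq_card_basis (Module.Basis.mk hli hsp), Fintype.card_fin]

theorem isDoubleCoverOfLine [CharZero K] (H : IsQuadraticModel h z y) (hh : Squarefree h)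
    {n : ℕ} (hn0 : 0 < n) (hn : h.natDegree = 2 * n) : IsDoubleCoverOfLine K F :=
  ⟨H.algebraicClosure_eq_bot hh hn0 hn, z, H.transcendental, H.finrank_adjoin hh (by omega)⟩

/-- Dividing `y` by `d` divides the right-hand side by `d ^ 2`. -/
theorem div_const {c d : K} (hd : d ≠ 0) (hc : d ^ 2 = c)
    (H : IsQuadraticModel (C c * h) z y) :
    IsQuadraticModel h z (y / algebraMap K F d) := by
  have hd' : algebraMap K F d ≠ 0 := by simpa using hd
  refine ⟨H.transcendental, ?_, ?_⟩
  · rw [div_pow, H.sq_eq, map_mul, aeval_C, ← hc, map_pow, mul_div_cancel_left₀ _ (by simpa)]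
  · rw [eq_top_iff, ← H.adjoin_eq_top, IntermediateField.adjoin_le_iff]
    rintro w (rfl | rfl)
    · exact IntermediateField.subset_adjoin _ _ (by simp)
    · have h1 : w / algebraMap K F d ∈
          IntermediateField.adjoin K {z, w / algebraMap K F d} :=
        IntermediateField.subset_adjoin _ _ (by simp)
      have := mul_mem h1 (IntermediateField.algebraMap_mem _ d)
      rwa [div_mul_cancel₀ _ hd'] at this

end IsQuadraticModel

end Quadratic

end AlgCurve

namespace DihedralCover

/-! ### Chebyshev polynomials and the minimal polynomial of `-ζ - ζ⁻¹`. -/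

section Chebyshev

theorem aeval_chebyshev_C_add_inv {R S : Type*} [CommRing R] [Field S] [Algebra R S] {s : S}
    (hs : s ≠ 0) (n : ℕ) : aeval (s + s⁻¹) (Chebyshev.C R n) = s ^ n + s⁻¹ ^ n := by
  rw [aeval_def, eval₂_eq_eval_map, Chebyshev.map_C, ← dickson_one_one_eq_chebyshev_C,
    dickson_one_one_eval_add_inv _ _ (mul_inv_cancel₀ hs)]

/-- At `s + 1/s` this reads `(s^n - s^(-n))² = (s - 1/s)² S²`. With the derivative formula below it
serves to prove `C_l + b` separable. -/
theorem chebyshev_C_sq_sub_four (R : Type*) [CommRing R] (n : ℤ) :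
    Chebyshev.C R n ^ 2 - 4 = (X ^ 2 - 4) * Chebyshev.S R (n - 1) ^ 2 := by
  have h := Chebyshev.S_sq_add_S_sq R (n - 1)
  rw [sub_add_cancel] at h
  rw [Chebyshev.C_eq_S_sub_X_mul_S]
  linear_combination 4 * h

theorem derivative_chebyshev_C (K : Type*) [Field K] [CharZero K] (n : ℤ) :
    derivative (Chebyshev.C K n) = n * Chebyshev.S K (n - 1) := by
  have h := congrArg derivative (Chebyshev.C_comp_two_mul_X K n)
  rw [derivative_comp] at h
  simp only [derivative_mul, derivative_ofNat, derivative_X, zero_mul, mul_one, zero_add,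
    Chebyshev.T_derivative_eq_U, ← Chebyshev.S_comp_two_mul_X] at h
  have h2 : (derivative (Chebyshev.C K n)).comp (2 * X) =
      ((n : K[X]) * Chebyshev.S K (n - 1)).comp (2 * X) := by
    apply mul_left_cancel₀ (two_ne_zero (α := K[X]))
    rw [h, mul_comp, intCast_comp]
  have h3 := congrArg (fun p : K[X] => p.comp (C 2⁻¹ * X)) h2
  have h4 : ((2 : K[X]) * X).comp (C 2⁻¹ * X) = X := by
    rw [show (2 : K[X]) = C 2 from rfl, mul_comp, X_comp, C_comp, ← mul_assoc, ← C_mul,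
      mul_inv_cancel₀ two_ne_zero, C_1, one_mul]
  simpa only [comp_assoc, h4, comp_X] using h3

/-- The polynomials `g` with `w * g(w ^ 2 - 2)` the Chebyshev polynomials `C` of odd index. -/
def oddFactor (R : Type*) [CommRing R] : ℕ → R[X]
  | 0 => 1
  | 1 => X - 1
  | n + 2 => X * oddFactor R (n + 1) - oddFactor R n

/-- The recursion is `C_(k+2) + C_(k-2) = C_k C_2` with `C_2 = w² - 2`, divided by `w`. -/
theorem X_mul_oddFactor_comp (R : Type*) [CommRing R] (n : ℕ) :
    X * (oddFactor R n).comp (X ^ 2 - 2) = Chebyshev.C R (2 * n + 1 : ℕ) := by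
  induction n using Nat.twoStepInduction with
  | zero => simp [oddFactor]
  | one =>
    have h := Chebyshev.C_add_two R 1
    norm_num at h
    simp only [oddFactor]
    norm_num
    rw [h, Chebyshev.C_two]
    ring
  | more n h1 h2 =>
    have h := Chebyshev.C_mul_C R (2 * n + 1 + 2) 2
    rw [Chebyshev.C_two, add_sub_cancel_right] at h
    simp only [oddFactor, sub_comp, mul_comp, X_comp]
    push_cast at h1 h2 ⊢
    rw [show (2 * ((n : ℤ) + 2) + 1) = 2 * n + 1 + 2 + 2 by ring]
    rw [show (2 * ((n : ℤ) + 1) + 1) = 2 * n + 1 + 2 by ring] at h2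
    linear_combination h + (X ^ 2 - 2) * h2 - h1

theorem monic_and_natDegree_oddFactor (R : Type*) [CommRing R] [Nontrivial R] (n : ℕ) :
    (oddFactor R n).Monic ∧ (oddFactor R n).natDegree = n := by
  induction n using Nat.twoStepInduction with
  | zero => simp [oddFactor]
  | one =>
    rw [oddFactor, ← C_1]
    exact ⟨monic_X_sub_C 1, natDegree_X_sub_C 1⟩
  | more n h1 h2 =>
    have hm : (X * oddFactor R (n + 1)).Monic := monic_X.mul h2.1
    have hd : (X * oddFactor R (n + 1)).natDegree = n + 2 := by
      rw [monic_X.natDegree_mul h2.1, natDegree_X, h2.2]; omega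
    have hlt : (oddFactor R n).natDegree < (X * oddFactor R (n + 1)).natDegree := by
      rw [h1.2, hd]; omega
    rw [oddFactor]
    exact ⟨hm.sub_of_left (degree_lt_degree hlt),
      (natDegree_sub_eq_left_of_natDegree_lt hlt).trans hd⟩

/-- If `s² = -ζ`, then `(s + 1/s)² - 2 = -ζ - ζ⁻¹` and `C_l(s + 1/s) = s^l + s^(-l) = 0`, because
`s^(2l) = -1`. This exhibits the root. The degree cannot be smaller than `(l-1)/2`: `ζ` is a root of
`X² + cX + 1` over `ℚ(c)` and has degree `l - 1` over `ℚ`. -/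
theorem minpoly_neg_add_inv {l : ℕ} (hl : l.Prime) (hl2 : l ≠ 2) {ζ : ℂ}
    (hζ : IsPrimitiveRoot ζ l) : minpoly ℚ (-ζ - ζ⁻¹) = oddFactor ℚ ((l - 1) / 2) := by
  have hodd := hl.odd_of_ne_two hl2
  have hl' : 2 * ((l - 1) / 2) + 1 = l := by obtain ⟨k, rfl⟩ := hodd; omega
  have h3 : 3 ≤ l := by have := hl.two_le; omega
  have hζ0 : ζ ≠ 0 := hζ.ne_zero hl.ne_zero
  set c := -ζ - ζ⁻¹ with hc
  obtain ⟨hmon, hdeg⟩ := monic_and_natDegree_oddFactor ℚ ((l - 1) / 2)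
  have hroot : aeval c (oddFactor ℚ ((l - 1) / 2)) = 0 := by
    obtain ⟨s, hs⟩ := IsAlgClosed.exists_pow_nat_eq (-ζ) two_pos
    have hs0 : s ≠ 0 := by rintro rfl; simp [hζ0] at hs
    have hw : s + s⁻¹ ≠ 0 := fun h0 => by
      have h1 : s ^ 2 + 1 = 0 := by
        have := congrArg (s * ·) h0
        simp only [mul_add, mul_inv_cancel₀ hs0, mul_zero] at this
        rw [sq, this]
      exact hζ.ne_one (by omega) (by linear_combination hs - h1)
    have hsl : s ^ l + s⁻¹ ^ l = 0 := by
      have h1 : s ^ l * s ^ l = -1 := by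
        rw [← mul_pow, ← sq, hs, hodd.neg_pow, hζ.pow_eq_one]
      have : s ^ l ≠ 0 := pow_ne_zero _ hs0
      rw [inv_pow]
      field_simp
      linear_combination h1
    have h := congrArg (aeval (s + s⁻¹)) (X_mul_oddFactor_comp ℚ ((l - 1) / 2))
    rw [hl', aeval_chebyshev_C_add_inv hs0, hsl, map_mul, aeval_X, aeval_comp] at h
    have h2 : aeval (s + s⁻¹) (X ^ 2 - 2 : ℚ[X]) = c := by
      have h4 : ζ = -s ^ 2 := by rw [hs, neg_neg]
      simp only [map_sub, map_pow, aeval_X, map_ofNat]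
      rw [hc, h4]
      field_simp
      ring
    rw [h2] at h
    exact (mul_eq_zero.1 h).resolve_left hw
  have hcint : IsIntegral ℚ c := ⟨_, hmon, hroot⟩
  refine (eq_of_monic_of_dvd_of_natDegree_le (minpoly.monic hcint) hmon
    (minpoly.dvd ℚ c hroot) ?_).symm
  let E := IntermediateField.adjoin ℚ {c}
  let M := IntermediateField.adjoin E {ζ}
  have hE : Module.finrank ℚ E = (minpoly ℚ c).natDegree :=
    IntermediateField.adjoin.finrank hcint
  have : FiniteDimensional ℚ E := IntermediateField.adjoin.finiteDimensional hcint
  have hζE : IsIntegral E ζ := (hζ.isIntegral hl.pos).tower_top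
  have : FiniteDimensional E M := IntermediateField.adjoin.finiteDimensional hζE
  have hM : Module.finrank E M ≤ 2 := by
    rw [IntermediateField.adjoin.finrank hζE]
    let c' : E := ⟨c, IntermediateField.mem_adjoin_simple_self ℚ c⟩
    have hq0 : (X ^ 2 + C c' * X + 1 : E[X]).natDegree = 2 := by compute_degree!
    have hqm : (X ^ 2 + C c' * X + 1 : E[X]) ≠ 0 := fun h0 => by
      rw [h0, natDegree_zero] at hq0
      omega
    rw [← hq0]
    refine natDegree_le_of_dvd (minpoly.dvd _ _ ?_) hqm
    simp only [map_add, map_mul, map_pow, aeval_X, aeval_C, map_one]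
    change ζ ^ 2 + c * ζ + 1 = 0
    rw [hc]
    field_simp
    ring
  have : FiniteDimensional ℚ M := FiniteDimensional.trans ℚ E M
  have hdegζ : (minpoly ℚ ζ).natDegree = l - 1 := by
    rw [← cyclotomic_eq_minpoly_rat hζ hl.pos, natDegree_cyclotomic, Nat.totient_prime hl]
  have hle : (minpoly ℚ ζ).natDegree ≤ Module.finrank ℚ M := by
    have := minpoly.natDegree_le (A := ℚ) (IntermediateField.AdjoinSimple.gen E ζ)
    rwa [← minpoly.algebraMap_eq (algebraMap M ℂ).injective,
      IntermediateField.AdjoinSimple.algebraMap_gen] at this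
  rw [hdeg]
  rw [hdegζ, ← Module.finrank_mul_finrank ℚ E M, hE] at hle
  have := hle.trans (Nat.mul_le_mul_left _ hM)
  omega

end Chebyshev

/-! ### Degrees and separability of the models. -/

section Models

variable {K : Type*} [Field K]

theorem monic_and_natDegree_chebyshev_C {l : ℕ} (hl : Odd l) :
    (Chebyshev.C K l).Monic ∧ (Chebyshev.C K l).natDegree = l := by
  have hl' : 2 * ((l - 1) / 2) + 1 = l := by obtain ⟨k, rfl⟩ := hl; omega
  obtain ⟨hm, hd⟩ := monic_and_natDegree_oddFactor K ((l - 1) / 2)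
  have hq : (X ^ 2 - 2 : K[X]) = X ^ 2 - C 2 := rfl
  have hqm : (X ^ 2 - 2 : K[X]).Monic := by rw [hq]; exact monic_X_pow_sub_C _ two_ne_zero
  have hqd : (X ^ 2 - 2 : K[X]).natDegree = 2 := by rw [hq, natDegree_X_pow_sub_C]
  have hc := hm.comp hqm (by omega)
  rw [← hl', ← X_mul_oddFactor_comp]
  refine ⟨monic_X.mul hc, ?_⟩
  rw [monic_X.natDegree_mul hc, natDegree_X, natDegree_comp, hd, hqd]
  omega

theorem natDegree_modelY {l : ℕ} (hl : 0 < l) (b : K) : (modelY l b).natDegree = 2 * l := by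
  have h : (C b * X ^ l + 1 : K[X]).natDegree < (X ^ (2 * l) : K[X]).natDegree := by
    rw [natDegree_X_pow, ← C_1, natDegree_add_C]
    exact (natDegree_C_mul_X_pow_le b l).trans_lt (by omega)
  rw [modelY, add_assoc, natDegree_add_eq_left_of_natDegree_lt h, natDegree_X_pow]

variable [CharZero K]

theorem modelX_eq {l : ℕ} (hl : l.Prime) (hl2 : l ≠ 2) {ζ : ℂ} (hζ : IsPrimitiveRoot ζ l) (b : K) :
    modelX ζ b = (X + 2) * (Chebyshev.C K l + C b) := by
  have hodd := hl.odd_of_ne_two hl2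
  have hl' : 2 * ((l - 1) / 2) + 1 = l := by obtain ⟨k, rfl⟩ := hodd; omega
  have h := congrArg (Polynomial.map (algebraMap ℚ K)) (X_mul_oddFactor_comp ℚ ((l - 1) / 2))
  rw [hl', Chebyshev.map_C, Polynomial.map_mul, map_X, map_comp] at h
  simp only [Polynomial.map_sub, Polynomial.map_pow, map_X, Polynomial.map_ofNat] at h
  rw [modelX, minpoly_neg_add_inv hl hl2 hζ, h]

theorem natDegree_modelX {l : ℕ} (hl : l.Prime) (hl2 : l ≠ 2) {ζ : ℂ} (hζ : IsPrimitiveRoot ζ l)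
    (b : K) : (modelX ζ b).natDegree = l + 1 := by
  obtain ⟨hm, hd⟩ := monic_and_natDegree_chebyshev_C (K := K) (hl.odd_of_ne_two hl2)
  have hb : (Chebyshev.C K l + C b).natDegree = l := by rw [natDegree_add_C, hd]
  have h0 : Chebyshev.C K l + C b ≠ 0 := fun h0 => by
    rw [h0, natDegree_zero] at hb; exact hl.ne_zero hb.symm
  rw [modelX_eq hl hl2 hζ, show (X + 2 : K[X]) = X + C 2 from rfl,
    natDegree_mul (X_add_C_ne_zero _) h0, hb, natDegree_X_add_C, add_comm]

theorem separable_modelX {l : ℕ} (hl : l.Prime) (hl2 : l ≠ 2) {ζ : ℂ} (hζ : IsPrimitiveRoot ζ l)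
    {b : K} (hb : b ^ 2 ≠ 4) : (modelX ζ b).Separable := by
  have hodd := hl.odd_of_ne_two hl2
  rw [modelX_eq hl hl2 hζ]
  refine Separable.mul (separable_X_add_C 2) ?_ ?_
  · have hl0 : (l : K) ≠ 0 := Nat.cast_ne_zero.2 hl.ne_zero
    have hder : derivative (Chebyshev.C K l + C b) = C (l : K) * Chebyshev.S K (l - 1) := by
      rw [derivative_add, derivative_C, add_zero, derivative_chebyshev_C]
      simp
    have h1 := chebyshev_C_sq_sub_four K l
    have hb' : b ^ 2 - 4 ≠ 0 := sub_ne_zero.2 hb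
    have h2 : (C (b ^ 2 - 4)⁻¹ : K[X]) * (C b ^ 2 - 4) = 1 := by
      rw [show (4 : K[X]) = C 4 from rfl, ← C_pow, ← C_sub, ← C_mul, inv_mul_cancel₀ hb', C_1]
    have h3 : (C (l : K)⁻¹ : K[X]) * C (l : K) = 1 := by
      rw [← C_mul, inv_mul_cancel₀ hl0, C_1]
    rw [separable_def, hder]
    -- The Bézout relation is `b² - 4 = (C_l² - 4) - (C_l - b)(C_l + b)`, where `C_l² - 4 = (X² -
    -- 4)S²` is a multiple of the derivative `l S`.
    refine ⟨-C (b ^ 2 - 4)⁻¹ * (Chebyshev.C K l - C b),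
      C (b ^ 2 - 4)⁻¹ * C (l : K)⁻¹ * (X ^ 2 - 4) * Chebyshev.S K (l - 1), ?_⟩
    linear_combination h2 - C (b ^ 2 - 4)⁻¹ * h1 +
      C (b ^ 2 - 4)⁻¹ * (X ^ 2 - 4) * Chebyshev.S K (l - 1) ^ 2 * h3
  · have hb' : b - 2 ≠ 0 := fun h0 => hb (by linear_combination (b + 2) * h0)
    -- As `l` is odd, `C_l(-2) = -2`; so `-2` is a root of `C_l + b` only for `b = 2`.
    have hev : (Chebyshev.C K l + C b).eval (-2) = b - 2 := by
      rw [eval_add, eval_C, Chebyshev.C_eval_neg_two, Int.negOnePow_odd _ (by exact_mod_cast hodd)]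
      simp
      ring
    obtain ⟨k, hk⟩ := X_sub_C_dvd_sub_C_eval (a := (-2 : K)) (p := Chebyshev.C K l + C b)
    rw [hev, C_neg, sub_neg_eq_add] at hk
    have h3 : (C (b - 2)⁻¹ : K[X]) * C (b - 2) = 1 := by
      rw [← C_mul, inv_mul_cancel₀ hb', C_1]
    refine ⟨-C (b - 2)⁻¹ * k, C (b - 2)⁻¹, ?_⟩
    have h2C : (2 : K[X]) = C 2 := rfl
    rw [h2C]
    linear_combination h3 + C (b - 2)⁻¹ * hk

theorem separable_modelY {l : ℕ} (hl : 0 < l) {b : K} (hb : b ^ 2 ≠ 4) :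
    (modelY l b).Separable := by
  have hb' : b ^ 2 - 4 ≠ 0 := sub_ne_zero.2 hb
  have hl0 : (l : K) ≠ 0 := Nat.cast_ne_zero.2 hl.ne'
  have h2 : (C (b ^ 2 - 4)⁻¹ : K[X]) * (C b ^ 2 - 4) = 1 := by
    rw [show (4 : K[X]) = C 4 from rfl, ← C_pow, ← C_sub, ← C_mul, inv_mul_cancel₀ hb', C_1]
  have h3 : (C (l : K)⁻¹ : K[X]) * C (l : K) = 1 := by
    rw [← C_mul, inv_mul_cancel₀ hl0, C_1]
  have hder : X * derivative (modelY l b) = C (l : K) * (2 * (X ^ l) ^ 2 + C b * X ^ l) := by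
    obtain ⟨k, rfl⟩ := Nat.exists_eq_add_of_lt hl
    simp only [modelY, derivative_add, derivative_one, derivative_X_pow, derivative_C_mul,
      zero_add, add_zero, Nat.add_sub_cancel, show 2 * (k + 1) - 1 = 2 * k + 1 by omega]
    simp only [map_natCast]
    push_cast
    ring
  have hmod : modelY l b = (X ^ l) ^ 2 + C b * X ^ l + 1 := by rw [modelY, ← pow_mul, mul_comm l]
  rw [separable_def]
  generalize derivative (modelY l b) = q at hder ⊢
  rw [hmod]
  generalize (X : K[X]) ^ l = u at hder ⊢
  -- With `Q = u² + bu + 1`, one has `u(u+b) = Q - 1` and `(2u+b)² = 4Q + (b²-4)`. Hence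
  -- `-(u+b)(2u+b)` times `u(2u+b)` is `b² - 4` modulo `Q`.
  refine ⟨-C (b ^ 2 - 4)⁻¹ * (4 - (C b ^ 2 - 4) - 4 * (u ^ 2 + C b * u + 1)),
    -C (b ^ 2 - 4)⁻¹ * C (l : K)⁻¹ * (u + C b) * (2 * u + C b) * X, ?_⟩
  linear_combination (-C (b ^ 2 - 4)⁻¹ * C (l : K)⁻¹ * (u + C b) * (2 * u + C b)) * hder +
    (-C (b ^ 2 - 4)⁻¹ * (u + C b) * (2 * u + C b) * (2 * u ^ 2 + C b * u)) * h3 + h2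

/-- In fact `b² - 4 = 64a/(1-4a)²`. -/
theorem paramB_sq_ne_four {a : K} (ha : a ≠ 0) (ha' : 1 - 4 * a ≠ 0) : paramB a ^ 2 ≠ 4 := by
  intro h
  rw [paramB] at h
  field_simp at h
  apply ha
  have : (64 : K) * a = 0 := by linear_combination h
  simpa using this

end Models

open AlgCurve PlaneCurve

/-! ### The model of `Y`, the involution and its fixed field. -/

section Involution

variable {K : Type*} [Field K] {F : Type*} [Field F] [Algebra K F]

theorem reverse_C_mul_modelY {l : ℕ} (hl : 0 < l) {c : K} (hc : c ≠ 0) (b : K) :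
    (C c * modelY l b).reverse = C c * modelY l b := by
  rw [reverse, natDegree_C_mul hc, natDegree_modelY hl, reflect_C_mul, modelY, reflect_add,
    reflect_add, reflect_C_mul, ← pow_zero (X : K[X]), reflect_monomial, reflect_monomial,
    reflect_monomial, revAt_le le_rfl, revAt_le (by omega), revAt_le (by omega)]
  rw [Nat.sub_self, Nat.sub_zero, show 2 * l - l = l by omega]
  ring

/-- The second coordinate of the model of `Y`. -/
def modelCoord (l : ℕ) (x t : F) : F := 2 * (t ^ l - 1) * x - (t ^ l + 1)

theorem modelCoord_sq [CharZero K] {l : ℕ} {a : K} (ha' : 1 - 4 * a ≠ 0) {x t : F}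
    (e : t ^ l * (x ^ 2 - x + algebraMap K F a) = x ^ 2 + x + algebraMap K F a) :
    modelCoord l x t ^ 2 = aeval t (C (1 - 4 * a) * modelY l (paramB a)) := by
  have hb : (1 - 4 * a) * paramB a = 2 * (1 + 4 * a) := by rw [paramB]; field_simp
  have hb' := congrArg (algebraMap K F) hb
  simp only [map_mul, map_sub, map_add, map_one, map_ofNat] at hb'
  simp only [modelY, map_mul, map_add, map_pow, aeval_X, aeval_C, map_one, map_sub, map_ofNat,
    modelCoord]
  rw [mul_comm 2 l, pow_mul]
  linear_combination (4 * (t ^ l - 1)) * e - t ^ l * hb'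

/-- If `t` were algebraic, the quadratic relation would make `x` algebraic over the constants. That
relation is nontrivial because `T - 1` and `T + 1` do not both vanish. -/
theorem transcendental_of_relation [CharZero K] {l : ℕ} {a : K} {x t : F}
    (hx : Transcendental K x)
    (e : t ^ l * (x ^ 2 - x + algebraMap K F a) = x ^ 2 + x + algebraMap K F a) :
    Transcendental K t := by
  intro ht
  have : CharZero F := charZero_of_injective_algebraMap (algebraMap K F).injective
  have htl : t ^ l ∈ algebraicClosure K F := mem_algebraicClosure_iff.2 (ht.pow l)
  let T : algebraicClosure K F := ⟨t ^ l, htl⟩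
  let P : (algebraicClosure K F)[X] :=
    C (T - 1) * X ^ 2 + C (-(T + 1)) * X + C ((T - 1) * algebraMap K _ a)
  have hP : P ≠ 0 := by
    intro h0
    have hcoeff : ∀ u v w : algebraicClosure K F,
        C u * X ^ 2 + C v * X + C w = 0 → u = 0 ∧ v = 0 := fun u v w h0 => by
      have h1 := congrArg (fun p => p.coeff 1) h0
      have h2 := congrArg (fun p => p.coeff 2) h0
      simp [coeff_C] at h1 h2
      exact ⟨h2, h1⟩
    obtain ⟨h1, h2⟩ := hcoeff _ _ _ h0
    have h3 : (2 : algebraicClosure K F) = 0 := by linear_combination -h1 - h2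
    exact two_ne_zero h3
  have hxalg : IsAlgebraic (algebraicClosure K F) x := by
    refine ⟨P, hP, ?_⟩
    simp only [P, map_add, map_mul, map_pow, aeval_X, aeval_C]
    change (t ^ l - 1) * x ^ 2 + -(t ^ l + 1) * x + (t ^ l - 1) * algebraMap K F a = 0
    linear_combination e
  exact hx (hxalg.restrictScalars K)

theorem isQuadraticModel_modelY [CharZero K] {l : ℕ} {a : K} (ha' : 1 - 4 * a ≠ 0) {x t : F}
    (hx : Transcendental K x)
    (e : t ^ l * (x ^ 2 - x + algebraMap K F a) = x ^ 2 + x + algebraMap K F a)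
    (htop : IntermediateField.adjoin K {x, t} = ⊤) :
    IsQuadraticModel (C (1 - 4 * a) * modelY l (paramB a)) t (modelCoord l x t) ∧
      t ^ l - 1 ≠ 0 := by
  have : CharZero F := charZero_of_injective_algebraMap (algebraMap K F).injective
  have hT : t ^ l - 1 ≠ 0 := by
    intro h0
    have hx0 : x = 0 := by
      have h2 : 2 * x = 0 := by linear_combination (x ^ 2 - x + algebraMap K F a) * h0 - e
      simpa using h2
    exact hx (hx0 ▸ isAlgebraic_zero)
  refine ⟨⟨transcendental_of_relation hx e, modelCoord_sq ha' e, ?_⟩, hT⟩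
  rw [eq_top_iff, ← htop, IntermediateField.adjoin_le_iff]
  set M := IntermediateField.adjoin K {t, modelCoord l x t}
  have ht : t ∈ M := IntermediateField.subset_adjoin _ _ (by simp)
  have hy : modelCoord l x t ∈ M := IntermediateField.subset_adjoin _ _ (by simp)
  rintro w (rfl | rfl)
  · have hw : w = (modelCoord l w t + (t ^ l + 1)) / (2 * (t ^ l - 1)) := by
      rw [modelCoord]; field_simp; ring
    rw [hw]
    exact div_mem (add_mem hy (add_mem (pow_mem ht l) (one_mem M)))
      (mul_mem (ofNat_mem M 2) (sub_mem (pow_mem ht l) (one_mem M)))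
  · exact ht

theorem mem_fixedField_zpowers {α : F ≃ₐ[K] F} {f : F} (hf : α f = f) :
    f ∈ IntermediateField.fixedField (Subgroup.zpowers α) := by
  rw [IntermediateField.mem_fixedField_iff]
  have h : Subgroup.zpowers α ≤ MulAction.stabilizer (F ≃ₐ[K] F) f := by
    rw [Subgroup.zpowers_le]
    exact hf
  exact fun g hg => h hg

theorem apply_eq_of_mem_fixedField_zpowers {α : F ≃ₐ[K] F} {f : F}
    (hf : f ∈ IntermediateField.fixedField (Subgroup.zpowers α)) : α f = f :=
  (IntermediateField.mem_fixedField_iff _ _).1 hf α (Subgroup.mem_zpowers α)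

/-- Put `E = K(t + 1/t, μ)`. Since `t² = (t + 1/t)t - 1`, the set `E + Et` is a field, hence all of
`F`. As `α` fixes `E`, invariance of `A + Bt` means `B(t - 1/t) = 0`. -/
theorem fixedField_eq_adjoin {α : F ≃ₐ[K] F} {t μ : F} (ht0 : t ≠ 0) (ht : t ^ 2 ≠ 1)
    (hαt : α t = t⁻¹) (hαμ : α μ = μ) (htop : IntermediateField.adjoin K {t, μ} = ⊤) :
    IntermediateField.fixedField (Subgroup.zpowers α) =
      IntermediateField.adjoin K {t + t⁻¹, μ} := by
  set E := IntermediateField.adjoin K {t + t⁻¹, μ} with hE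
  have hw : t + t⁻¹ ∈ E := IntermediateField.subset_adjoin _ _ (by simp)
  have hμ : μ ∈ E := IntermediateField.subset_adjoin _ _ (by simp)
  have hle : E ≤ IntermediateField.fixedField (Subgroup.zpowers α) := by
    rw [hE, IntermediateField.adjoin_le_iff]
    rintro f (rfl | rfl)
    · exact mem_fixedField_zpowers (by rw [map_add, map_inv₀, hαt, inv_inv, add_comm])
    · exact mem_fixedField_zpowers hαμ
  have hα : ∀ f ∈ E, α f = f := fun f hf => apply_eq_of_mem_fixedField_zpowers (hle hf)
  have hrep : ∀ f : F, ∃ A ∈ E, ∃ B ∈ E, f = A + B * t := by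
    intro f
    have hf : f ∈ IntermediateField.adjoin K {t, μ} := by rw [htop]; trivial
    induction hf using IntermediateField.adjoin_induction with
    | mem w hw =>
      rcases hw with rfl | rfl
      · exact ⟨0, zero_mem _, 1, one_mem _, by ring⟩
      · exact ⟨w, hμ, 0, zero_mem _, by ring⟩
    | algebraMap c => exact ⟨_, E.algebraMap_mem c, 0, zero_mem _, by ring⟩
    | add u v _ _ hu hv =>
      obtain ⟨A, hA, B, hB, rfl⟩ := hu
      obtain ⟨A', hA', B', hB', rfl⟩ := hv
      exact ⟨_, add_mem hA hA', _, add_mem hB hB', by ring⟩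
    | mul u v _ _ hu hv =>
      obtain ⟨A, hA, B, hB, rfl⟩ := hu
      obtain ⟨A', hA', B', hB', rfl⟩ := hv
      refine ⟨A * A' - B * B', sub_mem (mul_mem hA hA') (mul_mem hB hB'),
        A * B' + B * A' + B * B' * (t + t⁻¹),
        add_mem (add_mem (mul_mem hA hB') (mul_mem hB hA')) (mul_mem (mul_mem hB hB') hw), ?_⟩
      field_simp
      ring
    | inv u _ hu =>
      obtain ⟨A, hA, B, hB, rfl⟩ := hu
      rcases eq_or_ne (A + B * t) 0 with h0 | h0
      · exact ⟨0, zero_mem _, 0, zero_mem _, by rw [h0, inv_zero]; ring⟩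
      -- This is the norm `(A + Bt)(A + B/t)`, a product of two nonzero conjugates; the inverse is
      -- `A + B/t` over the norm, with `1/t` rewritten as `(t + 1/t) - t`.
      have hN : A ^ 2 + A * B * (t + t⁻¹) + B ^ 2 ≠ 0 := by
        have h1 : α (A + B * t) ≠ 0 := (map_ne_zero α).2 h0
        rw [map_add, map_mul, hα A hA, hα B hB, hαt] at h1
        have h2 := mul_ne_zero h0 h1
        convert h2 using 1
        field_simp
        ring
      have hNE : A ^ 2 + A * B * (t + t⁻¹) + B ^ 2 ∈ E :=
        add_mem (add_mem (pow_mem hA 2) (mul_mem (mul_mem hA hB) hw)) (pow_mem hB 2)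
      refine ⟨(A + B * (t + t⁻¹)) / (A ^ 2 + A * B * (t + t⁻¹) + B ^ 2),
        div_mem (add_mem hA (mul_mem hB hw)) hNE, -B / (A ^ 2 + A * B * (t + t⁻¹) + B ^ 2),
        div_mem (neg_mem hB) hNE, ?_⟩
      refine inv_eq_of_mul_eq_one_right ?_
      rw [div_mul_eq_mul_div, ← add_div, mul_div_assoc', div_eq_one_iff_eq hN]
      field_simp
      ring
  refine le_antisymm (fun f hf => ?_) hle
  obtain ⟨A, hA, B, hB, rfl⟩ := hrep f
  have h1 := apply_eq_of_mem_fixedField_zpowers hf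
  rw [map_add, map_mul, hα A hA, hα B hB, hαt] at h1
  field_simp at h1
  have h2 : B * (t ^ 2 - 1) = 0 := by linear_combination -h1
  have h3 := (mul_eq_zero.1 h2).resolve_right (sub_ne_zero.2 ht)
  rw [h3, zero_mul, add_zero]
  exact hA

theorem exists_isQuadraticModel_fixedField [CharZero K] {l : ℕ} (hl : l.Prime) (hl2 : l ≠ 2)
    {ζ : ℂ} (hζ : IsPrimitiveRoot ζ l) {c b : K} {t y : F}
    (H : IsQuadraticModel (C c * modelY l b) t y) {α : F ≃ₐ[K] F} (hαt : α t = t⁻¹)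
    (hαy : α y = y * t⁻¹ ^ l) :
    ∃ w μ : IntermediateField.fixedField (Subgroup.zpowers α),
      IsQuadraticModel (C c * modelX ζ b) w μ := by
  have ht0 := H.z_ne_zero
  obtain ⟨m, hm⟩ : ∃ m, l + 1 = 2 * m := by
    obtain ⟨k, rfl⟩ := hl.odd_of_ne_two hl2; exact ⟨k + 1, by ring⟩
  have hne : ∀ p : K[X], p ≠ 0 → aeval t p ≠ 0 := fun p hp => H.aeval_ne_zero hp
  have ht1 : t + 1 ≠ 0 := by
    have := hne (X + C 1) (X_add_C_ne_zero 1)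
    simpa using this
  have ht2 : t ^ 2 ≠ 1 := by
    have := hne (X ^ 2 - C 1) (X_pow_sub_C_ne_zero two_pos 1)
    rw [← sub_ne_zero]
    simpa using this
  have htm : t ^ m * t ^ m = t ^ l * t := by rw [← pow_add, ← two_mul, ← hm, pow_succ]
  -- Under `α`, `y` acquires `t^(-l)` and `t + 1` acquires `t^(-1)`; the factor `t^(-m)` with `2m =
  -- l + 1` compensates both.
  set μ := y * (t + 1) * t⁻¹ ^ m with hμ
  have htl0 : t ^ l ≠ 0 := pow_ne_zero _ ht0
  have htm0 : t ^ m ≠ 0 := pow_ne_zero _ ht0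
  have hαμ : α μ = μ := by
    rw [hμ]
    simp only [map_mul, map_add, map_one, map_pow, map_inv₀, hαt, hαy, inv_inv, inv_pow]
    field_simp
    linear_combination y * (1 + t) * htm
  have htop : IntermediateField.adjoin K {t, μ} = ⊤ := by
    rw [eq_top_iff, ← H.adjoin_eq_top, IntermediateField.adjoin_le_iff]
    have h1 : t ∈ IntermediateField.adjoin K {t, μ} :=
      IntermediateField.subset_adjoin _ _ (by simp)
    have h2 : μ ∈ IntermediateField.adjoin K {t, μ} :=
      IntermediateField.subset_adjoin _ _ (by simp)
    rintro w (rfl | rfl)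
    · exact h1
    · have : w = μ * t ^ m / (t + 1) := by
        rw [hμ, inv_pow]; field_simp
      rw [this]
      exact div_mem (mul_mem h2 (pow_mem h1 m)) (add_mem h1 (one_mem _))
  have hX := fixedField_eq_adjoin ht0 ht2 hαt hαμ htop
  have hwX : t + t⁻¹ ∈ IntermediateField.fixedField (Subgroup.zpowers α) := by
    rw [hX]; exact IntermediateField.subset_adjoin _ _ (by simp)
  have hμX : μ ∈ IntermediateField.fixedField (Subgroup.zpowers α) := mem_fixedField_zpowers hαμ
  refine ⟨⟨_, hwX⟩, ⟨μ, hμX⟩, ?_, ?_, ?_⟩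
  · intro halg
    have halg' : IsAlgebraic K (t + t⁻¹) :=
      halg.algHom (IntermediateField.fixedField (Subgroup.zpowers α)).val
    let W : algebraicClosure K F := ⟨t + t⁻¹, mem_algebraicClosure_iff.2 halg'⟩
    have hP : (X ^ 2 - C W * X + 1 : (algebraicClosure K F)[X]).natDegree = 2 := by
      compute_degree!
    have htalg : IsAlgebraic (algebraicClosure K F) t := by
      refine ⟨X ^ 2 - C W * X + 1, fun h0 => ?_, ?_⟩
      · rw [h0, natDegree_zero] at hP; omega
      · simp only [map_add, map_sub, map_mul, map_pow, aeval_X, aeval_C, map_one]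
        change t ^ 2 - (t + t⁻¹) * t + 1 = 0
        field_simp
        ring
    exact H.transcendental (htalg.restrictScalars K)
  · apply Subtype.ext
    have hval : ∀ p : K[X], ((aeval (⟨_, hwX⟩ :
        IntermediateField.fixedField (Subgroup.zpowers α)) p : _) : F) = aeval (t + t⁻¹) p :=
      fun p => by
        change (IntermediateField.fixedField (Subgroup.zpowers α)).val _ = _
        rw [← aeval_algHom_apply]
        rfl
    rw [hval]
    change μ ^ 2 = _
    have hy := H.sq_eq
    simp only [modelY, map_mul, map_add, map_pow, aeval_X, aeval_C, map_one] at hy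
    rw [mul_comm 2 l, pow_mul] at hy
    have h2 : aeval (t + t⁻¹) (2 : K[X]) = 2 := map_ofNat _ 2
    rw [modelX_eq hl hl2 hζ]
    simp only [map_mul, map_add, aeval_X, aeval_C, h2, aeval_chebyshev_C_add_inv ht0]
    have htm' : (t⁻¹ ^ m) ^ 2 = (t ^ l * t)⁻¹ := by rw [← htm, sq, inv_pow, mul_inv]
    rw [hμ, mul_pow, mul_pow, hy, htm', inv_pow]
    field_simp
    ring
  · rw [eq_top_iff]
    intro f _
    have hf : (f : F) ∈ IntermediateField.adjoin K {t + t⁻¹, μ} := hX ▸ f.2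
    have himg : ({t + t⁻¹, μ} : Set F) =
        (IntermediateField.fixedField (Subgroup.zpowers α)).val ''
          {⟨_, hwX⟩, ⟨μ, hμX⟩} := by
      rw [Set.image_pair]; rfl
    rw [himg, ← IntermediateField.adjoin_map, IntermediateField.mem_map] at hf
    obtain ⟨g, hg, hgf⟩ := hf
    rwa [← Subtype.ext hgf]

theorem exists_involution [CharZero K] {l : ℕ} (hl : 0 < l) {a : K} (ha : a ≠ 0)
    (ha' : 1 - 4 * a ≠ 0) {x t : F} (hT : t ^ l - 1 ≠ 0)
    (H : IsQuadraticModel (C (1 - 4 * a) * modelY l (paramB a)) t (modelCoord l x t)) :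
    ∃ α : F ≃ₐ[K] F, α x = -x ∧ α t = t⁻¹ ∧
      α (modelCoord l x t) = modelCoord l x t * t⁻¹ ^ l := by
  have : CharZero F := charZero_of_injective_algebraMap (algebraMap K F).injective
  have hsep : (C (1 - 4 * a) * modelY l (paramB a)).Separable :=
    Separable.unit_mul (isUnit_C.2 ha'.isUnit) (separable_modelY hl (paramB_sq_ne_four ha ha'))
  have hdeg : (C (1 - 4 * a) * modelY l (paramB a)).natDegree = 2 * l := by
    rw [natDegree_C_mul ha', natDegree_modelY hl]
  have H' := H.inv hdeg
  rw [reverse_C_mul_modelY hl ha'] at H'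
  -- The model is its own reversal, so the chart at infinity satisfies the same equation, and `α` is
  -- the exchange of the two charts.
  obtain ⟨α, hαt, hαy⟩ := H.exists_algEquiv H' hsep.squarefree (by omega)
  refine ⟨α, ?_, hαt, hαy⟩
  have ht0 : t ^ l ≠ 0 := pow_ne_zero _ H.z_ne_zero
  have h1 := hαy
  simp only [modelCoord, map_sub, map_mul, map_add, map_pow, map_one, map_ofNat, hαt,
    inv_pow] at h1
  field_simp at h1
  have h2 : (t ^ l - 1) * (2 * (α x + x)) = 0 := by linear_combination -h1
  have h3 := (mul_eq_zero.1 h2).resolve_left hT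
  have h4 : α x + x = 0 := by simpa using h3
  exact eq_neg_of_add_eq_zero_left h4

end Involution

/-! ### All assertions for an abstract field generated by `x` and `t`. -/

section Quotient

theorem models_of_relation {K F : Type*} [Field K] [CharZero K] [Field F] [Algebra K F] {l : ℕ}
    (hl : l.Prime) (hl2 : l ≠ 2) {a : K} (ha : a ≠ 0) (ha' : 1 - 4 * a ≠ 0) {ζ : ℂ}
    (hζ : IsPrimitiveRoot ζ l) {x t : F} (hx : Transcendental K x)
    (e : t ^ l * (x ^ 2 - x + algebraMap K F a) = x ^ 2 + x + algebraMap K F a)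
    (htop : IntermediateField.adjoin K {x, t} = ⊤) :
    genus K F = l - 1 ∧
    IsHyperelliptic K F ∧
    HasModel K F (C (1 - 4 * a) * modelY l (paramB a)) ∧
    (∀ d : K, d ^ 2 = 1 - 4 * a →
      HasModel K F (modelY l (paramB a))) ∧
    ∃ α : F ≃ₐ[K] F,
      α x = -x ∧
      α t = t⁻¹ ∧
      genus K (IntermediateField.fixedField (Subgroup.zpowers α)) = (l - 1) / 2 ∧
      IsDoubleCoverOfLine K (IntermediateField.fixedField (Subgroup.zpowers α)) ∧
      (l ≠ 3 → IsHyperelliptic K (IntermediateField.fixedField (Subgroup.zpowers α))) ∧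
      HasModel K (IntermediateField.fixedField (Subgroup.zpowers α))
        (C (1 - 4 * a) * modelX ζ (paramB a)) ∧
      (∀ d : K, d ^ 2 = 1 - 4 * a →
        HasModel K (IntermediateField.fixedField (Subgroup.zpowers α))
          (modelX ζ (paramB a))) := by
  have hl0 := hl.pos
  have hl3 : 3 ≤ l := by have := hl.two_le; omega
  have hodd := hl.odd_of_ne_two hl2
  have hb := paramB_sq_ne_four ha ha'
  have hu : IsUnit (C (1 - 4 * a)) := isUnit_C.2 ha'.isUnit
  have hd0 : ∀ d : K, d ^ 2 = 1 - 4 * a → d ≠ 0 := by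
    rintro d hd rfl
    exact ha' (by rw [← hd]; ring)
  obtain ⟨HY, hT⟩ := isQuadraticModel_modelY ha' hx e htop
  have hYsep' := separable_modelY hl0 hb
  have hYdeg' := natDegree_modelY hl0 (paramB a)
  have hYsep := Separable.unit_mul hu hYsep'
  have hYdeg : (C (1 - 4 * a) * modelY l (paramB a)).natDegree = 2 * l := by
    rw [natDegree_C_mul ha', hYdeg']
  have hYgenus := HY.genus_eq hYsep (by omega) hYdeg
  have hXsep' := separable_modelX hl hl2 hζ hb
  obtain ⟨m, hm⟩ : ∃ m, l + 1 = 2 * m := by obtain ⟨k, rfl⟩ := hodd; exact ⟨k + 1, by ring⟩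
  have hXdeg' : (modelX ζ (paramB a)).natDegree = 2 * m :=
    (natDegree_modelX hl hl2 hζ (paramB a)).trans hm
  have hXsep := Separable.unit_mul hu hXsep'
  have hXdeg : (C (1 - 4 * a) * modelX ζ (paramB a)).natDegree = 2 * m := by
    rw [natDegree_C_mul ha', hXdeg']
  obtain ⟨α, hαx, hαt, hαy⟩ := exists_involution hl0 ha ha' hT HY
  obtain ⟨w, μ, HX⟩ := exists_isQuadraticModel_fixedField hl hl2 hζ HY hαt hαy
  have hXgenus := HX.genus_eq hXsep (by omega) hXdeg
  have hXcover := HX.isDoubleCoverOfLine hXsep.squarefree (by omega) hXdeg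
  refine ⟨hYgenus, ⟨HY.isDoubleCoverOfLine hYsep.squarefree hl0 hYdeg, by rw [hYgenus]; omega⟩,
    HY.hasModel hYsep (by omega),
    fun d hd => (HY.div_const (hd0 d hd) hd).hasModel hYsep' (by omega),
    α, hαx, hαt, by rw [hXgenus]; omega, hXcover, fun h3 => ⟨hXcover, ?_⟩,
    HX.hasModel hXsep (by omega),
    fun d hd => (HX.div_const (hd0 d hd) hd).hasModel hXsep' (by omega)⟩
  rw [hXgenus]
  omega

end Quotient

/-! ### The coordinate functions of the plane curve satisfy the abstract assumptions. -/

section FunctionField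

variable {K : Type*} [Field K]

/-- Needed for `K[x]` to embed in the coordinate ring, which makes `x` transcendental. -/
theorem degree_poly_ne_zero {l : ℕ} (hl : l ≠ 0) (a : K) : (poly l a).degree ≠ 0 := by
  intro h0
  have h1 : (poly l a).coeff l = 0 := by
    refine coeff_eq_zero_of_degree_lt ?_
    rw [h0]
    exact_mod_cast hl.bot_lt
  rw [poly, coeff_sub, coeff_C_mul, coeff_X_pow, if_pos rfl, coeff_C, if_neg hl, mul_one,
    sub_zero] at h1
  have := congrArg (fun p : K[X] => p.coeff 2) h1
  simp [coeff_X] at this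

variable {l : ℕ} {a : K}

theorem aeval_coordX (p : K[X]) : aeval (coordX (poly l a)) p =
    algebraMap (CoordinateRing (poly l a)) _ (AdjoinRoot.of _ p) := by
  induction p using Polynomial.induction_on' with
  | add p q hp hq => rw [map_add, hp, hq, map_add, map_add]
  | monomial n c =>
    rw [aeval_monomial, ← C_mul_X_pow_eq_monomial, map_mul, map_mul, map_pow, map_pow]
    rfl

theorem transcendental_coordX (hl : l ≠ 0) : Transcendental K (coordX (poly l a)) := by
  rw [transcendental_iff_injective]
  intro p q hpq
  rw [aeval_coordX, aeval_coordX] at hpq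
  exact AdjoinRoot.of.injective_of_degree_ne_zero (degree_poly_ne_zero hl a)
    (IsFractionRing.injective (CoordinateRing (poly l a)) _ hpq)

theorem coord_relation : coordY (poly l a) ^ l * (coordX (poly l a) ^ 2 - coordX (poly l a) +
      algebraMap K (FunctionField (poly l a)) a) =
    coordX (poly l a) ^ 2 + coordX (poly l a) + algebraMap K (FunctionField (poly l a)) a := by
  have h := congrArg (algebraMap (CoordinateRing (poly l a)) (FunctionField (poly l a)))
    (AdjoinRoot.mk_self (f := poly l a))
  conv_lhs at h => arg 2; arg 2; rw [poly]
  rw [map_sub, map_mul, map_pow, AdjoinRoot.mk_C, AdjoinRoot.mk_C, AdjoinRoot.mk_X, map_sub,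
    map_mul, map_pow, ← aeval_coordX, ← aeval_coordX, map_zero] at h
  simp only [map_add, map_sub, map_pow, aeval_X, aeval_C] at h
  rw [coordY]
  linear_combination h

variable [Fact (Irreducible (poly l a))]

theorem adjoin_coord_eq_top :
    IntermediateField.adjoin K {coordX (poly l a), coordY (poly l a)} = ⊤ := by
  rw [eq_top_iff]
  intro f _
  set M := IntermediateField.adjoin K {coordX (poly l a), coordY (poly l a)}
  have hx : coordX (poly l a) ∈ M := IntermediateField.subset_adjoin _ _ (by simp)
  have hy : coordY (poly l a) ∈ M := IntermediateField.subset_adjoin _ _ (by simp)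
  have h : ∀ u : CoordinateRing (poly l a),
      algebraMap _ (FunctionField (poly l a)) u ∈ M := by
    intro u
    obtain ⟨g, rfl⟩ := AdjoinRoot.mk_surjective u
    induction g using Polynomial.induction_on' with
    | add p q hp hq => rw [map_add, map_add]; exact add_mem hp hq
    | monomial n p =>
      rw [← C_mul_X_pow_eq_monomial, map_mul, map_mul, map_pow, map_pow, AdjoinRoot.mk_C,
        AdjoinRoot.mk_X, ← aeval_coordX]
      refine mul_mem ?_ (pow_mem hy n)
      rw [aeval_eq_sum_range]
      exact sum_mem fun i _ => M.smul_mem (pow_mem hx i)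
  obtain ⟨u, v, _, rfl⟩ := IsFractionRing.div_surjective (CoordinateRing (poly l a)) f
  exact div_mem (h u) (h v)

end FunctionField

end DihedralCover

end

open PlaneCurve AlgCurve DihedralCover in
theorem proposition2p2 {K : Type*} [Field K] [CharZero K] (l : ℕ) (hl : l.Prime) (hl2 : l ≠ 2)
    (a : K) (ha : a ≠ 0) (ha' : 1 - 4 * a ≠ 0) (ζ : ℂ) (hζ : IsPrimitiveRoot ζ l) :
    haveI : Fact (Irreducible (poly l a)) := ⟨irreducible_poly hl.ne_zero ha ha'⟩
    -- the curve `Y`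
    genus K (FunctionField (poly l a)) = l - 1 ∧
    IsHyperelliptic K (FunctionField (poly l a)) ∧
    HasModel K (FunctionField (poly l a)) (C (1 - 4 * a) * modelY l (paramB a)) ∧
    (∀ d : K, d ^ 2 = 1 - 4 * a →
      HasModel K (FunctionField (poly l a)) (modelY l (paramB a))) ∧
    -- the involution `α` and the quotient `X = Y / ⟨α⟩`
    ∃ α : FunctionField (poly l a) ≃ₐ[K] FunctionField (poly l a),
      α (coordX (poly l a)) = -coordX (poly l a) ∧
      α (coordY (poly l a)) = (coordY (poly l a))⁻¹ ∧
      genus K (IntermediateField.fixedField (Subgroup.zpowers α)) = (l - 1) / 2 ∧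
      IsDoubleCoverOfLine K (IntermediateField.fixedField (Subgroup.zpowers α)) ∧
      (l ≠ 3 → IsHyperelliptic K (IntermediateField.fixedField (Subgroup.zpowers α))) ∧
      HasModel K (IntermediateField.fixedField (Subgroup.zpowers α))
        (C (1 - 4 * a) * modelX ζ (paramB a)) ∧
      (∀ d : K, d ^ 2 = 1 - 4 * a →
        HasModel K (IntermediateField.fixedField (Subgroup.zpowers α))
          (modelX ζ (paramB a))) := by
  have : Fact (Irreducible (poly l a)) := ⟨irreducible_poly hl.ne_zero ha ha'⟩
  exact models_of_relation hl hl2 ha ha' hζ (transcendental_coordX hl.ne_zero) coord_relation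
    adjoin_coord_eq_top
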